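/- **Theorem 1 (Nonlinear stability of steady solutions of the GHM equation).** Let $\lambda,\sigma>0$ be constants, let $\Omega\subset\mathbb{R}^3$ be a bounded open set, and let $\boldsymbol{B}:\overline\Omega\to\mathbb{R}^3$ and $A_e:\overline\Omega\to\mathbb{R}$ be of class $C^2(\overline\Omega)$ with $\min_{\overline\Omega}|\boldsymbol{B}|>0$ and $\min_{\overline\Omega}A_e>0$. (A function is of class $C^k$ up to the boundary if it is $C^k$ in the interior and it and its derivatives up to order $k$ extend continuously to the boundary.) Write $B=|\boldsymbol{B}|$, $$\nabla_\perp\chi=-\frac{\boldsymbol{B}\times(\boldsymbol{B}\times\nabla\chi)}{B^2},\qquad \boldsymbol{v}_{\boldsymbol{E}}^{\chi}=\frac{\boldsymbol{B}\times\nabla\chi}{B^2},\qquad \mathcal{D}\chi=\lambda A_e\chi-\sigma\nabla\cdot\Big(A_e\frac{\nabla_\perp\chi}{B^2}\Big).$$ The generalized Hasegawa–Mima (GHM) equation is $$\frac{\partial}{\partial t}\mathcal{D}\chi=\nabla\cdot\Big[A_e\Big(\sigma\frac{\boldsymbol{B}\cdot\nabla\times\boldsymbol{v}_{\boldsymbol{E}}^{\chi}}{B^2}-1\Big)\boldsymbol{v}_{\boldsymbol{E}}^{\chi}\Big].$$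 By a global classical solution we mean a function $\chi\in C^2(\overline\Omega\times[0,\infty))$ such that the vector field in square brackets is differentiable in $\Omega$ at every time, the equation holds at every point of $\Omega\times[0,\infty)$, and its two sides extend continuously to $\overline\Omega\times[0,\infty)$. For $\gamma,\nu\in\mathbb{R}$ and $w:\mathbb{R}\to\mathbb{R}$ let $\mathfrak{H}_\Omega=H_\Omega+\gamma M_\Omega+\nu W_\Omega$, where $$M_\Omega=\int_\Omega A_e(1+\lambda\chi)\,d\boldsymbol{x},\quad H_\Omega=\frac12\int_\Omega A_e\Big(\lambda\chi^2+\sigma\frac{|\nabla_\perp\chi|^2}{B^2}\Big)d\boldsymbol{x},\quad W_\Omega=\int_\Omega A_e\,w\Big(\frac{\mathcal{D}\chi}{A_e}\Big)d\boldsymbol{x}.$$ Suppose that * if $\nabla\times(A_e\boldsymbol{B}/B^2)=\boldsymbol{0}$ in $\Omega$, then $w$ is twice differentiable and $0<c_m\le\nu w''\le c_M<\infty$ on $\mathbb{R}$ for some constants $c_m,c_M$; * if $\nabla\times(A_e\boldsymbol{B}/B^2)\not\equiv\boldsymbol{0}$ in $\Omega$, then $\nu=0$. Let $\chi_0\in C^2(\overline\Omega)$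 be a critical point of $\mathfrak{H}_\Omega$, that is, $\frac{d}{ds}\mathfrak{H}_\Omega[\chi_0+sh]\big|_{s=0}=0$ for every $h\in C^2(\overline\Omega)$ with $h=0$ on $\partial\Omega$, and suppose that $A_e(\chi_0+\gamma)=0$ on $\partial\Omega$ (since $A_e>0$ on $\overline\Omega$, this means $\chi_0=-\gamma$ on $\partial\Omega$). Then $\chi_0$ is nonlinearly stable: there is a constant $\mathfrak{C}>0$ such that every global classical solution $\chi$ of the GHM equation with $\chi(t)=\chi_0$ on $\partial\Omega$ for all $t\ge0$ satisfies $$\|\chi(t)-\chi_0\|_\perp^2\le\mathfrak{C}\,\|\chi(0)-\chi_0\|_\perp^2\qquad\text{for all }t\ge0,$$ where $\|\chi\|_\perp^2=\|\chi\|^2_{L^2(\Omega)}+\|\nabla_\perp\chi\|^2_{L^2(\Omega)}+\|\mathcal{D}\chi\|^2_{L^2(\Omega)}$ if $\nabla\times(A_e\boldsymbol{B}/B^2)=\boldsymbol{0}$ in $\Omega$, and $\|\chi\|_\perp^2=\|\chi\|^2_{L^2(\Omega)}+\|\nabla_\perp\chi\|^2_{L^2(\Omega)}$ otherwise. -/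

import Mathlib

open MeasureTheory Set

noncomputable section

namespace GHM

/-- Physical space `ℝ³` with its Euclidean norm. -/
abbrev E3 : Type := EuclideanSpace ℝ (Fin 3)

/-- The cross product on `ℝ³`. -/
def cross (u v : E3) : E3 :=
  WithLp.toLp 2 (crossProduct (WithLp.ofLp u) (WithLp.ofLp v))

/-- The partial derivative `∂ F_j / ∂ x_i` of a vector field. -/
def pd (F : E3 → E3) (i j : Fin 3) (x : E3) : ℝ :=
  fderiv ℝ F x (EuclideanSpace.single i 1) j

/-- The divergence of a vector field. -/
def dive (F : E3 → E3) (x : E3) : ℝ := ∑ i, pd F i i x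

/-- The curl of a vector field. -/
def curl (F : E3 → E3) (x : E3) : E3 :=
  !₂[pd F 1 2 x - pd F 2 1 x, pd F 2 0 x - pd F 0 2 x, pd F 0 1 x - pd F 1 0 x]

/-- `f` is of class `Cⁿ` on `s` up to the boundary: `f` is continuous on the closure of `s`, it is
`Cⁿ` on `s`, and its derivatives up to order `n` extend continuously to the closure of `s`. -/
def ContDiffUpTo {X Y : Type*} [NormedAddCommGroup X] [NormedSpace ℝ X] [NormedAddCommGroup Y]
    [NormedSpace ℝ Y] (n : ℕ) (f : X → Y) (s : Set X) : Prop :=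
  ContinuousOn f (closure s) ∧
    ∃ p : X → FormalMultilinearSeries ℝ X Y, HasFTaylorSeriesUpToOn n f p s ∧
      ∀ m ≤ n, ContinuousOn (fun x => p x m) (closure s)

/-- The perpendicular gradient `∇_⊥ χ = - B⁻² B × (B × ∇χ)`. -/
def gradPerp (B : E3 → E3) (χ : E3 → ℝ) (x : E3) : E3 :=
  -((‖B x‖ ^ 2)⁻¹ • cross (B x) (cross (B x) (gradient χ x)))

/-- The drift velocity `v_E^χ = B × ∇χ / B²`. -/
def vE (B : E3 → E3) (χ : E3 → ℝ) (x : E3) : E3 :=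
  (‖B x‖ ^ 2)⁻¹ • cross (B x) (gradient χ x)

/-- The operator `𝒟χ = lam A_e χ - σ ∇ · (A_e ∇_⊥ χ / B²)`. -/
def opD (lam σ : ℝ) (Ae : E3 → ℝ) (B : E3 → E3) (χ : E3 → ℝ) (x : E3) : ℝ :=
  lam * Ae x * χ x - σ * dive (fun y => (Ae y / ‖B y‖ ^ 2) • gradPerp B χ y) x

/-- The vector field `A_e (σ B · ∇ × v_E^χ / B² - 1) v_E^χ`, whose divergence is the right-hand side
of the GHM equation. -/
def flux (σ : ℝ) (Ae : E3 → ℝ) (B : E3 → E3) (χ : E3 → ℝ) (x : E3) : E3 :=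
  (Ae x * (σ * (inner ℝ (B x) (curl (vE B χ) x) / ‖B x‖ ^ 2) - 1)) • vE B χ x

/-- `χ` (time first, then space) is a global classical solution, regular up to the boundary, of the
GHM equation `∂ₜ (𝒟χ) = ∇ · [A_e (σ B · ∇ × v_E^χ / B² - 1) v_E^χ]` in `Ω × [0, ∞)`. -/
structure IsSolution (lam σ : ℝ) (Ω : Set E3) (Ae : E3 → ℝ) (B : E3 → E3) (χ : ℝ → E3 → ℝ) :
    Prop where
  /-- `χ` is `C²` in `(t, x)` up to the boundary. -/
  contDiff : ContDiffUpTo 2 (Function.uncurry χ) (Ici (0 : ℝ) ×ˢ Ω)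
  /-- The divergence on the right-hand side is that of a differentiable vector field. -/
  flux_diff : ∀ t, 0 ≤ t → DifferentiableOn ℝ (flux σ Ae B (χ t)) Ω
  /-- The equation holds at every point (with a one-sided time derivative at `t = 0`). -/
  equation : ∀ t, 0 ≤ t → ∀ x ∈ Ω,
    HasDerivWithinAt (fun s => opD lam σ Ae B (χ s) x) (dive (flux σ Ae B (χ t)) x) (Ici 0) t
  /-- The two (equal) sides of the equation are continuous up to the boundary. -/
  rhs_cont : ∃ g : ℝ × E3 → ℝ, ContinuousOn g (Ici (0 : ℝ) ×ˢ closure Ω) ∧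
    ∀ t, 0 ≤ t → ∀ x ∈ Ω, g (t, x) = dive (flux σ Ae B (χ t)) x

/-- The mass `M_Ω`. -/
def mass (lam : ℝ) (Ω : Set E3) (Ae : E3 → ℝ) (χ : E3 → ℝ) : ℝ :=
  ∫ x in Ω, Ae x * (1 + lam * χ x)

/-- The energy `H_Ω`. -/
def energy (lam σ : ℝ) (Ω : Set E3) (Ae : E3 → ℝ) (B : E3 → E3) (χ : E3 → ℝ) : ℝ :=
  (1 / 2) * ∫ x in Ω, Ae x * (lam * χ x ^ 2 + σ * (‖gradPerp B χ x‖ ^ 2 / ‖B x‖ ^ 2))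

/-- The generalized enstrophy `W_Ω`. -/
def enstrophy (lam σ : ℝ) (Ω : Set E3) (Ae : E3 → ℝ) (B : E3 → E3) (w : ℝ → ℝ)
    (χ : E3 → ℝ) : ℝ :=
  ∫ x in Ω, Ae x * w (opD lam σ Ae B χ x / Ae x)

/-- The energy-Casimir functional `H_Ω + γ M_Ω + ν W_Ω`. -/
def energyCasimir (lam σ : ℝ) (Ω : Set E3) (Ae : E3 → ℝ) (B : E3 → E3) (γ ν : ℝ) (w : ℝ → ℝ)
    (χ : E3 → ℝ) : ℝ :=
  energy lam σ Ω Ae B χ + γ * mass lam Ω Ae χ + ν * enstrophy lam σ Ω Ae B w χ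

/-- `χ₀` is a critical point of the energy-Casimir functional: the first variation vanishes in the
direction of every variation that is `C²` up to the boundary and zero on the boundary. -/
def IsCritical (lam σ : ℝ) (Ω : Set E3) (Ae : E3 → ℝ) (B : E3 → E3) (γ ν : ℝ) (w : ℝ → ℝ)
    (χ₀ : E3 → ℝ) : Prop :=
  ∀ h : E3 → ℝ, ContDiffUpTo 2 h Ω → (∀ x ∈ frontier Ω, h x = 0) →
    HasDerivAt (fun s : ℝ => energyCasimir lam σ Ω Ae B γ ν w (fun x => χ₀ x + s * h x)) 0 0

/-- The integrability condition `∇ × (A_e B / B²) = 0` in `Ω`. -/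
def Integrability (Ω : Set E3) (Ae : E3 → ℝ) (B : E3 → E3) : Prop :=
  ∀ x ∈ Ω, curl (fun y => (Ae y / ‖B y‖ ^ 2) • B y) x = 0

open Classical in
/-- The square of the norm `‖·‖_⊥`. -/
def normPerpSq (lam σ : ℝ) (Ω : Set E3) (Ae : E3 → ℝ) (B : E3 → E3) (χ : E3 → ℝ) : ℝ :=
  (∫ x in Ω, χ x ^ 2) + (∫ x in Ω, ‖gradPerp B χ x‖ ^ 2) +
    if Integrability Ω Ae B then ∫ x in Ω, opD lam σ Ae B χ x ^ 2 else 0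

end GHM

end

noncomputable section

namespace GHM

open Filter Topology

/-! ### Vector calculus in `ℝ³` -/

/-! The argument is the energy-Casimir method. Since χ = -γ on the boundary, U = χ + γ vanishes
there, and up to a constant H + γM is half of the quadratic form `form` evaluated at U. The
difference h = χ(t) - χ₀ vanishes on the boundary, so it is an admissible variation. The form is
exactly quadratic; expanding it about χ₀ + γ and eliminating the first-order term by criticality
(`form_sub_of_isCritical`) shows that half of form(h, h), plus the second-order Taylor remainder of
νW (`casimirRemainder`), is a difference between conserved quantities and constants, hence constant
in time. Bounds on A_e, |B| and νw'' make this sum comparable, from above and below, with the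
squared norm of h (`exists_form_bounds`, `exists_casimirRemainder_bounds`), and comparing time t
with time 0 gives the estimate. Without integrability ν = 0 and the form alone suffices.

Energy is conserved because the flux is parallel to B × ∇χ: testing the equation with U and
integrating by parts leaves ∇χ · flux = 0. Conservation of W needs integrability. It makes V = A_e
v_E divergence free and turns the flux into (λχ - 1 - q)V with q = 𝒟χ / A_e, so that w'(q) ∇ · flux
= -∇ · (w(q)V). The last integral vanishes because V is tangent to the level sets of χ.

Two difficulties of regularity remain. The boundary of Ω is arbitrary, so every integration by parts
uses a cutoff φ(u) of a function u vanishing on the boundary, with φ = 0 near 0; such a cutoff has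
compact support in Ω, and the passage to the limit relies on ∇u = 0 almost everywhere on {u = 0}
(`ae_fderiv_eq_zero`). Moreover q is only continuous, as χ is only C². What is differentiable is qV,
because the flux is, and this is enough for the chain rule (`dive_comp_smul`). -/

theorem inner_eq_sum (u v : E3) : inner ℝ u v = u 0 * v 0 + u 1 * v 1 + u 2 * v 2 := by
  simp [PiLp.inner_apply, Fin.sum_univ_three, mul_comm]

@[simp] theorem cross_zero' (u v : E3) : cross u v 0 = u 1 * v 2 - u 2 * v 1 := by
  simp [cross, cross_apply]

@[simp] theorem cross_one' (u v : E3) : cross u v 1 = u 2 * v 0 - u 0 * v 2 := by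
  simp [cross, cross_apply]

@[simp] theorem cross_two' (u v : E3) : cross u v 2 = u 0 * v 1 - u 1 * v 0 := by
  simp [cross, cross_apply]

theorem ext_three {u v : E3} (h0 : u 0 = v 0) (h1 : u 1 = v 1) (h2 : u 2 = v 2) : u = v := by
  ext i
  fin_cases i
  · exact h0
  · exact h1
  · exact h2

theorem inner_cross_right_self (u v : E3) : inner ℝ v (cross u v) = 0 := by
  rw [inner_eq_sum]
  simp only [cross_zero', cross_one', cross_two']
  ring

theorem cross_smul_left (c : ℝ) (u v : E3) : cross (c • u) v = c • cross u v := by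
  refine ext_three ?_ ?_ ?_ <;> simp <;> ring

theorem cross_smul_right (c : ℝ) (u v : E3) : cross u (c • v) = c • cross u v := by
  refine ext_three ?_ ?_ ?_ <;> simp <;> ring

theorem cross_add_right (u v w : E3) : cross u (v + w) = cross u v + cross u w := by
  refine ext_three ?_ ?_ ?_ <;> simp <;> ring

@[simp] theorem cross_zero_right (u : E3) : cross u 0 = 0 := by
  refine ext_three ?_ ?_ ?_ <;> simp

theorem contDiff_cross {n : WithTop ℕ∞} : ContDiff ℝ n (fun p : E3 × E3 => cross p.1 p.2) := by
  rw [contDiff_euclidean]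
  intro i
  have h1 : ∀ j : Fin 3, ContDiff ℝ n (fun p : E3 × E3 => p.1 j) := fun j =>
    contDiff_euclidean.1 contDiff_fst j
  have h2 : ∀ j : Fin 3, ContDiff ℝ n (fun p : E3 × E3 => p.2 j) := fun j =>
    contDiff_euclidean.1 contDiff_snd j
  fin_cases i
  · simpa using ((h1 1).mul (h2 2)).sub ((h1 2).mul (h2 1))
  · simpa using ((h1 2).mul (h2 0)).sub ((h1 0).mul (h2 2))
  · simpa using ((h1 0).mul (h2 1)).sub ((h1 1).mul (h2 0))

theorem differentiableAt_coord {F : E3 → E3} {x : E3} (hF : DifferentiableAt ℝ F x) (j : Fin 3) :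
    DifferentiableAt ℝ (fun y => F y j) x :=
  differentiableAt_euclidean.1 hF j

theorem pd_eq {F : E3 → E3} {x : E3} (hF : DifferentiableAt ℝ F x) (i j : Fin 3) :
    pd F i j x = fderiv ℝ (fun y => F y j) x (EuclideanSpace.single i 1) := by
  have h := (EuclideanSpace.proj (𝕜 := ℝ) j : E3 →L[ℝ] ℝ).hasFDerivAt.comp x hF.hasFDerivAt
  have h' : HasFDerivAt (fun y => F y j)
    ((EuclideanSpace.proj (𝕜 := ℝ) j : E3 →L[ℝ] ℝ).comp (fderiv ℝ F x)) x := h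
  rw [h'.fderiv]
  rfl

theorem dive_eq {F : E3 → E3} {x : E3} {F' : E3 →L[ℝ] E3} (h : HasFDerivAt F F' x) :
    dive F x = ∑ i, F' (EuclideanSpace.single i 1) i := by
  simp only [dive, pd, h.fderiv]

theorem dive_congr {F G : E3 → E3} {x : E3} (h : F =ᶠ[𝓝 x] G) : dive F x = dive G x := by
  simp only [dive, pd, h.fderiv_eq]

theorem apply_eq_sum (L : E3 →L[ℝ] ℝ) (v : E3) :
    L v = ∑ i, v i * L (EuclideanSpace.single i 1) := by
  conv_lhs => rw [show v = ∑ i, v i • EuclideanSpace.single i (1 : ℝ) from by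
    refine ext_three ?_ ?_ ?_ <;> simp [Fin.sum_univ_three]]
  simp only [map_sum, map_smul, smul_eq_mul]

theorem dive_smul {ψ : E3 → ℝ} {F : E3 → E3} {x : E3} (hψ : DifferentiableAt ℝ ψ x)
    (hF : DifferentiableAt ℝ F x) :
    dive (fun y => ψ y • F y) x = ψ x * dive F x + fderiv ℝ ψ x (F x) := by
  rw [dive_eq (hψ.hasFDerivAt.fun_smul hF.hasFDerivAt), dive_eq hF.hasFDerivAt,
    apply_eq_sum (fderiv ℝ ψ x), Finset.mul_sum, ← Finset.sum_add_distrib]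
  refine Finset.sum_congr rfl fun i _ => ?_
  simp
  ring

theorem dive_add {F G : E3 → E3} {x : E3} (hF : DifferentiableAt ℝ F x)
    (hG : DifferentiableAt ℝ G x) : dive (fun y => F y + G y) x = dive F x + dive G x := by
  rw [dive_eq (hF.hasFDerivAt.fun_add hG.hasFDerivAt), dive_eq hF.hasFDerivAt, dive_eq hG.hasFDerivAt,
    ← Finset.sum_add_distrib]
  rfl

theorem dive_const_smul (c : ℝ) {F : E3 → E3} {x : E3} (hF : DifferentiableAt ℝ F x) :
    dive (fun y => c • F y) x = c * dive F x := by
  rw [dive_smul (differentiableAt_const c) hF]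
  simp

theorem dive_cross {F G : E3 → E3} {x : E3} (hF : DifferentiableAt ℝ F x)
    (hG : DifferentiableAt ℝ G x) :
    dive (fun y => cross (F y) (G y)) x =
      inner ℝ (G x) (curl F x) - inner ℝ (F x) (curl G x) := by
  have hc : DifferentiableAt ℝ (fun y => cross (F y) (G y)) x :=
    ((contDiff_cross (n := 1)).differentiable (by simp)).differentiableAt.comp x (hF.prodMk hG)
  have f := differentiableAt_coord hF
  have g := differentiableAt_coord hG
  have key : ∀ a b c d i : Fin 3,
      fderiv ℝ (fun y => F y a * G y b - F y c * G y d) x (EuclideanSpace.single i 1) =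
        F x a * pd G i b x + G x b * pd F i a x - (F x c * pd G i d x + G x d * pd F i c x) := by
    intro a b c d i
    rw [pd_eq hF, pd_eq hF, pd_eq hG, pd_eq hG,
      (((f a).hasFDerivAt.fun_mul (g b).hasFDerivAt).fun_sub
        ((f c).hasFDerivAt.fun_mul (g d).hasFDerivAt)).fderiv]
    simp
  simp only [dive, Fin.sum_univ_three]
  rw [pd_eq hc, pd_eq hc, pd_eq hc]
  simp only [cross_zero', cross_one', cross_two', key]
  rw [inner_eq_sum, inner_eq_sum]
  simp [curl]
  ring

theorem fderiv_apply_eq_inner (χ : E3 → ℝ) (x v : E3) :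
    fderiv ℝ χ x v = inner ℝ (gradient χ x) v := by
  simp [gradient]

theorem gradient_coord (χ : E3 → ℝ) (x : E3) (j : Fin 3) :
    gradient χ x j = fderiv ℝ χ x (EuclideanSpace.single j 1) := by
  rw [fderiv_apply_eq_inner, EuclideanSpace.inner_single_right]
  simp

theorem curl_gradient {χ : E3 → ℝ} {x : E3} (h : ContDiffAt ℝ 2 χ x) :
    curl (gradient χ) x = 0 := by
  have hd : DifferentiableAt ℝ (fderiv ℝ χ) x :=
    (h.fderiv_right (m := 1) (by norm_num)).differentiableAt (by simp)
  have hg : DifferentiableAt ℝ (gradient χ) x :=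
    ((InnerProductSpace.toDual ℝ E3).symm.toContinuousLinearEquiv.differentiableAt).comp x hd
  have hs : IsSymmSndFDerivAt ℝ χ x := h.isSymmSndFDerivAt (by simp)
  have hpd : ∀ i j, pd (gradient χ) i j x =
      fderiv ℝ (fderiv ℝ χ) x (EuclideanSpace.single i 1) (EuclideanSpace.single j 1) := by
    intro i j
    rw [pd_eq hg]
    simp only [gradient_coord]
    rw [(hd.hasFDerivAt.clm_apply (hasFDerivAt_const (EuclideanSpace.single j (1:ℝ)) x)).fderiv]
    simp
  have hsym : ∀ i j, pd (gradient χ) i j x = pd (gradient χ) j i x := fun i j => by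
    rw [hpd, hpd]; exact hs _ _
  refine ext_three ?_ ?_ ?_ <;> simp [curl] <;> rw [hsym, sub_self]

/-- Where a vector field vanishes, multiplying it by a merely continuous function keeps it
differentiable. -/
theorem hasFDerivAt_smul_of_eq_zero {c : E3 → ℝ} {V : E3 → E3} {V' : E3 →L[ℝ] E3} {x : E3}
    (hc : ContinuousAt c x) (hV : HasFDerivAt V V' x) (h0 : V x = 0) :
    HasFDerivAt (fun y => c y • V y) (c x • V') x := by
  have h1 : HasFDerivAt (fun y => c x • V y) (c x • V') x := hV.const_smul (c x)
  -- The error is a product of c y - c x = o(1) and V y = O(|y - x|).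
  have h2 : HasFDerivAt (fun y => (c y - c x) • V y) (0 : E3 →L[ℝ] E3) x := by
    rw [hasFDerivAt_iff_isLittleO_nhds_zero]
    have hO : (fun h => V (x + h)) =O[𝓝 0] fun h : E3 => h := by
      have := hV.isBigO_sub
      have h3 : Tendsto (fun h : E3 => x + h) (𝓝 0) (𝓝 x) := by
        have : Tendsto (fun h : E3 => x + h) (𝓝 0) (𝓝 (x + 0)) :=
          (continuous_const.add continuous_id).tendsto 0
        simpa using this
      simpa [Function.comp_def, h0] using this.comp_tendsto h3
    have ho : (fun h => c (x + h) - c x) =o[𝓝 0] fun _ : E3 => (1 : ℝ) := by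
      rw [Asymptotics.isLittleO_one_iff]
      have h3 : Tendsto (fun h : E3 => x + h) (𝓝 0) (𝓝 x) := by
        have : Tendsto (fun h : E3 => x + h) (𝓝 0) (𝓝 (x + 0)) :=
          (continuous_const.add continuous_id).tendsto 0
        simpa using this
      have := (hc.tendsto.comp h3).sub_const (c x)
      simpa [Function.comp_def] using this
    simpa [h0] using ho.smul_isBigO hO
  have h3 := h1.add h2
  rw [add_zero] at h3
  refine h3.congr_of_eventuallyEq (Eventually.of_forall fun y => ?_)
  simp [← add_smul]

/-- The chain rule for `∇ · (f(q) V)`, where `V` is divergence free and only `q V`, not `q`, is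
known to be differentiable. -/
theorem dive_comp_smul {q : E3 → ℝ} {V : E3 → E3} {f : ℝ → ℝ} {x : E3} (hq : ContinuousAt q x)
    (hV : DifferentiableAt ℝ V x) (hqV : DifferentiableAt ℝ (fun y => q y • V y) x)
    (hf : DifferentiableAt ℝ f (q x)) (hdiv : dive V x = 0) :
    DifferentiableAt ℝ (fun y => f (q y) • V y) x ∧
      dive (fun y => f (q y) • V y) x = deriv f (q x) * dive (fun y => q y • V y) x := by
  -- At a zero of V both fields have a multiple of V' as derivative, and V' has trace zero, so both
  -- sides vanish.
  by_cases h0 : V x = 0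
  · have h1 := hasFDerivAt_smul_of_eq_zero (c := fun y => f (q y))
      (ContinuousAt.comp (f := q) hf.continuousAt hq) hV.hasFDerivAt h0
    have h2 := hasFDerivAt_smul_of_eq_zero hq hV.hasFDerivAt h0
    refine ⟨h1.differentiableAt, ?_⟩
    rw [dive_eq h1, dive_eq h2]
    rw [dive_eq hV.hasFDerivAt] at hdiv
    simp [← Finset.mul_sum, hdiv]
  · have hne : ∀ᶠ y in 𝓝 x, V y ≠ 0 := hV.continuousAt.eventually_ne h0
    -- Where V ≠ 0, q is recovered as ⟨qV, V⟩ / |V|², a quotient of differentiable functions.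
    have hqd : DifferentiableAt ℝ q x := by
      have hn : ∀ v : E3, v ≠ 0 → inner ℝ v v ≠ 0 := fun v hv => by
        rw [real_inner_self_eq_norm_sq]
        exact pow_ne_zero 2 (norm_ne_zero_iff.2 hv)
      have ha : DifferentiableAt ℝ (fun y => inner ℝ (q y • V y) (V y)) x := hqV.inner ℝ hV
      have hb : DifferentiableAt ℝ (fun y => inner ℝ (V y) (V y)) x := hV.inner ℝ hV
      have h1 : DifferentiableAt ℝ (fun y => inner ℝ (q y • V y) (V y) * (inner ℝ (V y) (V y))⁻¹) x :=
        ha.fun_mul (hb.fun_inv (hn _ h0))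
      refine h1.congr_of_eventuallyEq ?_
      filter_upwards [hne] with y hy
      rw [real_inner_smul_left, mul_inv_cancel_right₀ (hn _ hy)]
    have hfq : HasFDerivAt (fun y => f (q y)) (deriv f (q x) • fderiv ℝ q x) x :=
      hf.hasDerivAt.comp_hasFDerivAt x hqd.hasFDerivAt
    refine ⟨hfq.differentiableAt.smul hV, ?_⟩
    rw [dive_smul hfq.differentiableAt hV, dive_smul hqd hV, hdiv, hfq.fderiv]
    simp

/-! ### Integration by parts on an arbitrary bounded open set -/

theorem integrableOn_of_continuousOn_of_bound {Ω : Set E3} (hΩo : IsOpen Ω)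
    (hΩb : Bornology.IsBounded Ω) {f : E3 → ℝ} (hf : ContinuousOn f Ω) {C : ℝ}
    (hC : ∀ x ∈ Ω, |f x| ≤ C) : IntegrableOn f Ω := by
  refine IntegrableOn.of_bound hΩb.measure_lt_top
    (hf.aestronglyMeasurable hΩo.measurableSet) C ?_
  rw [ae_restrict_iff' hΩo.measurableSet]
  exact Eventually.of_forall fun x hx => hC x hx

/-- The divergence theorem for a compactly supported field. -/
theorem integral_dive_eq_zero {G : E3 → E3} (hd : Differentiable ℝ G) (hs : HasCompactSupport G)
    (hi : Integrable (dive G)) : ∫ x, dive G x = 0 := by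
  obtain ⟨R, hR⟩ := hs.isCompact.isBounded.subset_closedBall 0
  have hz : ∀ x : E3, R < ‖x‖ → x ∉ tsupport G := fun x hx hxs => by
    have := hR hxs
    rw [mem_closedBall_zero_iff] at this
    linarith
  have hG0 : ∀ x : E3, R < ‖x‖ → G x = 0 := fun x hx => image_eq_zero_of_notMem_tsupport (hz x hx)
  have hD0 : ∀ x : E3, R < ‖x‖ → dive G x = 0 := fun x hx => by
    have h : fderiv ℝ G x = 0 := by
      by_contra h
      exact hz x hx (support_fderiv_subset ℝ h)
    simp [dive, pd, h]
  -- The faces of the cube [-r, r]³ lie outside the ball of radius R that contains the support; the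
  -- absolute value covers a negative R.
  let r : ℝ := |R| + 1
  have hr : R < r := by have := le_abs_self R; simp only [r]; linarith
  have hr0 : 0 < r := by positivity
  let e := EuclideanSpace.equiv (Fin 3) ℝ
  let f : (Fin 3 → ℝ) → (Fin 3 → ℝ) := fun y => e (G (e.symm y))
  let f' : (Fin 3 → ℝ) → (Fin 3 → ℝ) →L[ℝ] (Fin 3 → ℝ) := fun y =>
    (e : E3 →L[ℝ] (Fin 3 → ℝ)).comp ((fderiv ℝ G (e.symm y)).comp
      (e.symm : (Fin 3 → ℝ) →L[ℝ] E3))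
  have hf : ∀ y, HasFDerivAt f (f' y) y := fun y =>
    e.hasFDerivAt.comp y ((hd (e.symm y)).hasFDerivAt.comp y e.symm.hasFDerivAt)
  have hdiv : ∀ y, ∑ i, f' y (Pi.single i 1) i = dive G (WithLp.toLp 2 y) := fun y => by
    simp only [dive, pd]
    rfl
  have hvp := PiLp.volume_preserving_toLp (Fin 3)
  have hme : MeasurableEmbedding (WithLp.toLp 2 : (Fin 3 → ℝ) → E3) :=
    (MeasurableEquiv.toLp 2 (Fin 3 → ℝ)).measurableEmbedding
  have hint : Integrable (fun y : Fin 3 → ℝ => ∑ i, f' y (Pi.single i 1) i) := by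
    simp only [hdiv]
    exact (hvp.integrable_comp_emb hme).2 hi
  have hbig : ∀ (y : Fin 3 → ℝ) (i : Fin 3), r ≤ |y i| → R < ‖(WithLp.toLp 2 y : E3)‖ := by
    intro y i hy
    have := PiLp.norm_apply_le (WithLp.toLp 2 y : E3) i
    simp only [Real.norm_eq_abs] at this
    linarith
  have hmain := integral_divergence_of_hasFDerivAt_off_countable (fun _ : Fin 3 => -r)
    (fun _ => r) (fun _ => by linarith) f f' ∅ countable_empty
    (fun y _ => (hf y).continuousAt.continuousWithinAt) (fun y _ => hf y) hint.integrableOn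
  have hface : ∀ (i : Fin 3) (c : ℝ) (z : Fin 2 → ℝ), r ≤ |c| →
      f (i.insertNth (α := fun _ => ℝ) c z) i = 0 := by
    intro i c z hc
    have h0 : G (WithLp.toLp 2 (i.insertNth (α := fun _ => ℝ) c z)) = 0 :=
      hG0 _ (hbig _ i (by simpa using hc))
    change (G (WithLp.toLp 2 (i.insertNth (α := fun _ => ℝ) c z))) i = 0
    rw [h0]
    rfl
  rw [setIntegral_eq_integral_of_forall_compl_eq_zero] at hmain
  · simp only [hdiv] at hmain
    rw [hvp.integral_comp hme (dive G)] at hmain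
    rw [hmain]
    refine Finset.sum_eq_zero fun i _ => ?_
    simp only [hface i r _ (le_abs_self r), hface i (-r) _ (by rw [abs_neg]; exact le_abs_self r)]
    simp
  · intro y hy
    rw [hdiv]
    have : ∃ i, r ≤ |y i| := by
      by_contra! hcon
      exact hy ⟨fun i => (abs_lt.1 (hcon i)).1.le, fun i => (abs_lt.1 (hcon i)).2.le⟩
    obtain ⟨i, hyi⟩ := this
    exact hD0 _ (hbig y i hyi)

/-- The gradient vanishes at almost every point of the zero set. -/
theorem ae_fderiv_eq_zero {Ω : Set E3} (hΩo : IsOpen Ω) {u : E3 → ℝ} (hu : ContDiffOn ℝ 1 u Ω) :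
    ∀ᵐ x : E3, x ∈ Ω → u x = 0 → fderiv ℝ u x = 0 := by
  have hdiff : ∀ x ∈ Ω, DifferentiableAt ℝ u x := fun x hx =>
    (hu.differentiableOn (by simp)).differentiableAt (hΩo.mem_nhds hx)
  have hcont : ContinuousOn (fderiv ℝ u) Ω := hu.continuousOn_fderiv_of_isOpen hΩo (by simp)
  have key : ∀ i : Fin 3, ∀ᵐ x : E3,
      x ∈ {x | ¬ (x ∈ Ω ∧ u x = 0 ∧ fderiv ℝ u x (EuclideanSpace.single i 1) ≠ 0)} := by
    intro i
    let e : E3 := EuclideanSpace.single i 1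
    have h1 : IsOpen (Ω ∩ u ⁻¹' {0}ᶜ) :=
      hu.continuousOn.isOpen_inter_preimage hΩo isOpen_compl_singleton
    have h2 : IsOpen (Ω ∩ (fun x => fderiv ℝ u x e) ⁻¹' {0}ᶜ) :=
      (hcont.clm_apply continuousOn_const).isOpen_inter_preimage hΩo isOpen_compl_singleton
    have hms : MeasurableSet {x | ¬ (x ∈ Ω ∧ u x = 0 ∧ fderiv ℝ u x e ≠ 0)} := by
      have : {x | ¬ (x ∈ Ω ∧ u x = 0 ∧ fderiv ℝ u x e ≠ 0)} =
          ((Ω ∩ (fun x => fderiv ℝ u x e) ⁻¹' {0}ᶜ) \ (Ω ∩ u ⁻¹' {0}ᶜ))ᶜ := by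
        ext x
        simp
        tauto
      rw [this]
      exact (h2.measurableSet.diff h1.measurableSet).compl
    -- By Fubini it suffices to treat each line parallel to e.
    refine ae_mem_of_ae_add_linearMap_mem (LinearMap.toSpanSingleton ℝ E3 e) volume volume hms ?_
    intro y
    let S : Set ℝ := {s | y + s • e ∈ Ω ∧ u (y + s • e) = 0 ∧ fderiv ℝ u (y + s • e) e ≠ 0}
    -- Along the line u vanishes with nonzero derivative at each point of S, so these points are
    -- isolated in S.
    have hS : S.Countable := by
      refine (countable_setOfPred_isolated_right_within (s := S)).mono ?_
      intro s hs
      refine ⟨hs, ?_⟩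
      have hline : HasDerivAt (fun s : ℝ => u (y + s • e)) (fderiv ℝ u (y + s • e) e) s := by
        have h3 : HasDerivAt (fun s : ℝ => y + s • e) e s := by
          simpa using ((hasDerivAt_id s).smul_const e).const_add y
        exact (hdiff _ hs.1).hasFDerivAt.comp_hasDerivAt s h3
      have hev := hline.eventually_ne (c := 0) hs.2.2
      have hev2 : ∀ᶠ z in 𝓝[≠] s, z ∉ S := hev.mono fun z hz hzS => hz hzS.2.1
      have hbot : 𝓝[S \ {s}] s = ⊥ := by
        rw [← Filter.empty_mem_iff_bot, mem_nhdsWithin_iff_exists_mem_nhds_inter]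
        obtain ⟨v, hv, hvs⟩ := mem_nhdsWithin_iff_exists_mem_nhds_inter.1 hev2
        exact ⟨v, hv, fun z hz => hvs ⟨hz.1, hz.2.2⟩ hz.2.1⟩
      refine eq_bot_mono (nhdsWithin_mono s ?_) hbot
      intro z hz
      exact ⟨hz.1, ne_of_gt hz.2⟩
    filter_upwards [hS.ae_notMem volume] with s hs
    simpa [S, LinearMap.toSpanSingleton_apply] using hs
  filter_upwards [key 0, key 1, key 2] with x h0 h1 h2 hx hux
  ext v
  have h : ∀ i : Fin 3, fderiv ℝ u x (EuclideanSpace.single i 1) = 0 := by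
    intro i
    by_contra hne
    fin_cases i
    · exact h0 ⟨hx, hux, hne⟩
    · exact h1 ⟨hx, hux, hne⟩
    · exact h2 ⟨hx, hux, hne⟩
  rw [apply_eq_sum]
  simp [h]

/-- Integration by parts against `φ(u)`, where `φ` vanishes near `0` and `u` vanishes on the
boundary, so that `φ(u)` has compact support in `Ω`. -/
theorem integral_cutoff_mul_dive {Ω : Set E3} (hΩo : IsOpen Ω) (hΩb : Bornology.IsBounded Ω)
    {u : E3 → ℝ} (huc : ContinuousOn u (closure Ω)) (hu0 : ∀ x ∈ frontier Ω, u x = 0)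
    (hud : DifferentiableOn ℝ u Ω) {F : E3 → E3} (hF : DifferentiableOn ℝ F Ω) {φ : ℝ → ℝ}
    (hφ : Differentiable ℝ φ) {ε : ℝ} (hε : 0 < ε) (hφ0 : ∀ s, |s| < ε → φ s = 0)
    (hi : IntegrableOn
      (fun x => φ (u x) * dive F x + deriv φ (u x) * fderiv ℝ u x (F x)) Ω) :
    ∫ x in Ω, (φ (u x) * dive F x + deriv φ (u x) * fderiv ℝ u x (F x)) = 0 := by
  let G : E3 → E3 := Ω.indicator fun x => φ (u x) • F x
  -- By continuity |u| < ε in Ω near a boundary point, so φ(u) vanishes there and the extension of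
  -- φ(u)F by zero is differentiable everywhere.
  have hzero : ∀ x ∉ Ω, G =ᶠ[𝓝 x] fun _ => 0 := by
    intro x hx
    by_cases hxc : x ∈ closure Ω
    · have hxf : x ∈ frontier Ω := ⟨hxc, by rwa [hΩo.interior_eq]⟩
      have h1 : Tendsto u (𝓝[closure Ω] x) (𝓝 0) := by
        have := huc x hxc
        rwa [ContinuousWithinAt, hu0 x hxf] at this
      have h2 : ∀ᶠ y in 𝓝[closure Ω] x, |u y| < ε := by
        have := h1.abs
        rw [abs_zero] at this
        exact this.eventually_lt_const hε
      filter_upwards [eventually_nhdsWithin_iff.1 h2] with y hy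
      by_cases hyΩ : y ∈ Ω
      · simp only [G, indicator_of_mem hyΩ, hφ0 _ (hy (subset_closure hyΩ)), zero_smul]
      · simp only [G, indicator_of_notMem hyΩ]
    · filter_upwards [isClosed_closure.isOpen_compl.mem_nhds hxc] with y hy
      exact indicator_of_notMem (fun h => hy (subset_closure h)) _
  have hin : ∀ x ∈ Ω, G =ᶠ[𝓝 x] fun y => φ (u y) • F y := fun x hx => by
    filter_upwards [hΩo.mem_nhds hx] with y hy
    exact indicator_of_mem hy _
  have hφu : ∀ x ∈ Ω, HasFDerivAt (fun y => φ (u y)) (deriv φ (u x) • fderiv ℝ u x) x :=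
    fun x hx => (hφ (u x)).hasDerivAt.comp_hasFDerivAt x
      (hud.differentiableAt (hΩo.mem_nhds hx)).hasFDerivAt
  have hFd : ∀ x ∈ Ω, DifferentiableAt ℝ F x := fun x hx =>
    hF.differentiableAt (hΩo.mem_nhds hx)
  have hdG : Differentiable ℝ G := by
    intro x
    by_cases hx : x ∈ Ω
    · exact ((hφu x hx).differentiableAt.fun_smul (hFd x hx)).congr_of_eventuallyEq (hin x hx)
    · exact (differentiableAt_const (0 : E3)).congr_of_eventuallyEq (hzero x hx)
  have hdive : dive G = Ω.indicator
      fun x => φ (u x) * dive F x + deriv φ (u x) * fderiv ℝ u x (F x) := by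
    ext x
    by_cases hx : x ∈ Ω
    · rw [indicator_of_mem hx, dive_congr (hin x hx),
        dive_smul (hφu x hx).differentiableAt (hFd x hx), (hφu x hx).fderiv]
      simp
    · rw [indicator_of_notMem hx, dive_congr (hzero x hx)]
      simp [dive, pd]
  have hsupp : HasCompactSupport G := by
    refine HasCompactSupport.intro hΩb.isCompact_closure fun x hx => ?_
    exact indicator_of_notMem (fun h => hx (subset_closure h)) _
  have h := integral_dive_eq_zero hdG hsupp (by
    rw [hdive]
    exact (integrable_indicator_iff hΩo.measurableSet).2 hi)
  rwa [hdive, integral_indicator hΩo.measurableSet] at h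

/-- A smooth cutoff, `0` near the origin and `1` away from it. -/
def bump (s : ℝ) : ℝ := Real.smoothTransition (s ^ 2 - 1)

theorem contDiff_bump : ContDiff ℝ 1 bump :=
  Real.smoothTransition.contDiff.comp ((contDiff_id.pow 2).sub contDiff_const)

theorem bump_eq_zero {s : ℝ} (h : |s| ≤ 1) : bump s = 0 :=
  Real.smoothTransition.zero_of_nonpos (by
    have := (sq_le_one_iff_abs_le_one s).2 h
    linarith)

theorem bump_eq_one {s : ℝ} (h : 2 ≤ |s|) : bump s = 1 :=
  Real.smoothTransition.one_of_one_le (by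
    have : 2 ^ 2 ≤ |s| ^ 2 := pow_le_pow_left₀ (by norm_num) h 2
    rw [sq_abs] at this
    linarith)

theorem abs_bump_le (s : ℝ) : |bump s| ≤ 1 := by
  rw [bump, abs_of_nonneg (Real.smoothTransition.nonneg _)]
  exact Real.smoothTransition.le_one _

/-- The identity, smoothly truncated to `0` near the origin. -/
def truncId (s : ℝ) : ℝ := s * bump s

theorem contDiff_truncId : ContDiff ℝ 1 truncId := contDiff_id.mul contDiff_bump

theorem abs_truncId_le (s : ℝ) : |truncId s| ≤ |s| := by
  rw [truncId, abs_mul]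
  exact mul_le_of_le_one_right (abs_nonneg s) (abs_bump_le s)

theorem deriv_truncId_eq_one {s : ℝ} (h : 2 < |s|) : deriv truncId s = 1 := by
  have : truncId =ᶠ[𝓝 s] fun y => y := by
    filter_upwards [(continuous_abs.tendsto s).eventually_const_lt h] with y hy
    rw [truncId, bump_eq_one hy.le, mul_one]
  rw [this.deriv_eq, deriv_id'']

theorem exists_abs_deriv_truncId_le : ∃ M, ∀ s, |deriv truncId s| ≤ M := by
  obtain ⟨M, hM⟩ := (isCompact_Icc (a := (-2 : ℝ)) (b := 2)).exists_bound_of_continuousOn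
    (contDiff_truncId.continuous_deriv (by simp)).continuousOn
  refine ⟨max M 1, fun s => ?_⟩
  by_cases h : 2 < |s|
  · rw [deriv_truncId_eq_one h]
    simp
  · exact (hM s (abs_le.1 (not_lt.1 h))).trans (le_max_left _ _)

theorem eventually_two_lt_abs_mul {s : ℝ} (hs : s ≠ 0) :
    ∀ᶠ n : ℕ in atTop, 2 < |((n : ℝ) + 1) * s| := by
  have h1 : Tendsto (fun n : ℕ => ((n : ℝ) + 1) * |s|) atTop atTop :=
    (tendsto_atTop_add_const_right _ _ tendsto_natCast_atTop_atTop).atTop_mul_const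
      (abs_pos.2 hs)
  filter_upwards [h1.eventually_gt_atTop 2] with n hn
  rwa [abs_mul, abs_of_nonneg (by positivity : (0 : ℝ) ≤ (n : ℝ) + 1)]

theorem deriv_comp_const_mul {φ : ℝ → ℝ} (hφ : Differentiable ℝ φ) (N s : ℝ) :
    HasDerivAt (fun s => φ (N * s)) (N * deriv φ (N * s)) s := by
  have h1 : HasDerivAt (fun s => N * s) N s := by simpa using (hasDerivAt_id s).const_mul N
  have h : HasDerivAt (fun s => φ (N * s)) (deriv φ (N * s) * N) s :=
    (hφ (N * s)).hasDerivAt.comp s h1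
  rwa [mul_comm] at h

theorem tendsto_setIntegral_of_bound {Ω : Set E3} (hΩo : IsOpen Ω) (hΩb : Bornology.IsBounded Ω)
    {f : ℕ → E3 → ℝ} {g : E3 → ℝ} {K : ℝ}
    (hf : ∀ n, ContinuousOn (f n) Ω) (hb : ∀ n, ∀ x ∈ Ω, |f n x| ≤ K)
    (hlim : ∀ᵐ x : E3, x ∈ Ω → Tendsto (fun n => f n x) atTop (𝓝 (g x))) :
    Tendsto (fun n => ∫ x in Ω, f n x) atTop (𝓝 (∫ x in Ω, g x)) := by
  refine tendsto_integral_of_dominated_convergence (fun _ => K)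
    (fun n => (hf n).aestronglyMeasurable hΩo.measurableSet) ?_ ?_ ?_
  · exact integrableOn_const hΩb.measure_lt_top.ne
  · intro n
    rw [ae_restrict_iff' hΩo.measurableSet]
    exact Eventually.of_forall fun x hx => hb n x hx
  · rw [ae_restrict_iff' hΩo.measurableSet]
    exact hlim

/-- Integration by parts, with `u` vanishing on the boundary of an arbitrary bounded open set. -/
theorem integral_mul_dive_add {Ω : Set E3} (hΩo : IsOpen Ω) (hΩb : Bornology.IsBounded Ω)
    {u : E3 → ℝ} (huc : ContinuousOn u (closure Ω)) (hu0 : ∀ x ∈ frontier Ω, u x = 0)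
    (hu : ContDiffOn ℝ 1 u Ω) {F : E3 → E3} (hF : DifferentiableOn ℝ F Ω)
    (hdc : ContinuousOn (dive F) Ω) {C : ℝ} (hdb : ∀ x ∈ Ω, |dive F x| ≤ C)
    (hub : ∀ x ∈ Ω, |u x| ≤ C) (hgb : ∀ x ∈ Ω, |fderiv ℝ u x (F x)| ≤ C) :
    ∫ x in Ω, (u x * dive F x + fderiv ℝ u x (F x)) = 0 := by
  obtain ⟨M, hM⟩ := exists_abs_deriv_truncId_le
  have hM0 : 0 ≤ M := (abs_nonneg _).trans (hM 0)
  have htd : Differentiable ℝ truncId := contDiff_truncId.differentiable (by simp)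
  have hgc : ContinuousOn (fun x => fderiv ℝ u x (F x)) Ω :=
    (hu.continuousOn_fderiv_of_isOpen hΩo (by simp)).clm_apply hF.continuousOn
  -- φ n vanishes for |s| ≤ 1/(n+1) and is the identity for |s| ≥ 2/(n+1). The two factors n + 1
  -- cancel in its derivative, which is therefore bounded uniformly in n.
  let φ : ℕ → ℝ → ℝ := fun n s => truncId (((n : ℝ) + 1) * s) / ((n : ℝ) + 1)
  have hφd : ∀ n s, HasDerivAt (φ n) (deriv truncId (((n : ℝ) + 1) * s)) s := by
    intro n s
    have hn : ((n : ℝ) + 1) ≠ 0 := by positivity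
    have h := (deriv_comp_const_mul htd ((n : ℝ) + 1) s).div_const ((n : ℝ) + 1)
    rwa [mul_div_cancel_left₀ _ hn] at h
  have hφb : ∀ n s, |φ n s| ≤ |s| := by
    intro n s
    have hn : (0 : ℝ) < (n : ℝ) + 1 := by positivity
    have := abs_truncId_le (((n : ℝ) + 1) * s)
    simp only [φ]
    rw [abs_div, abs_of_pos hn, div_le_iff₀ hn, mul_comm |s|]
    rwa [abs_mul, abs_of_pos hn] at this
  let f : ℕ → E3 → ℝ := fun n x =>
    φ n (u x) * dive F x + deriv (φ n) (u x) * fderiv ℝ u x (F x)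
  have hfc : ∀ n, ContinuousOn (f n) Ω := by
    intro n
    have h1 : Continuous (φ n) :=
      continuous_iff_continuousAt.2 fun s => (hφd n s).continuousAt
    have h2 : Continuous (deriv (φ n)) := by
      rw [show deriv (φ n) = fun s => deriv truncId (((n : ℝ) + 1) * s) from
        funext fun s => (hφd n s).deriv]
      exact (contDiff_truncId.continuous_deriv (by simp)).comp (continuous_const.mul continuous_id)
    exact ((h1.comp_continuousOn hu.continuousOn).mul hdc).add
      ((h2.comp_continuousOn hu.continuousOn).mul hgc)
  have hfb : ∀ n, ∀ x ∈ Ω, |f n x| ≤ C * C + M * C := by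
    intro n x hx
    have hC : 0 ≤ C := (abs_nonneg _).trans (hub x hx)
    refine (abs_add_le _ _).trans (add_le_add ?_ ?_)
    · rw [abs_mul]
      exact mul_le_mul ((hφb n _).trans (hub x hx)) (hdb x hx) (abs_nonneg _) hC
    · rw [abs_mul, (hφd n (u x)).deriv]
      exact mul_le_mul (hM _) (hgb x hx) (abs_nonneg _) hM0
  have hzero : ∀ n, ∫ x in Ω, f n x = 0 := by
    intro n
    have hn : (0 : ℝ) < (n : ℝ) + 1 := by positivity
    refine integral_cutoff_mul_dive hΩo hΩb huc hu0 (hu.differentiableOn (by simp)) hF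
      (fun s => (hφd n s).differentiableAt) (ε := 1 / ((n : ℝ) + 1)) (by positivity) ?_
      (integrableOn_of_continuousOn_of_bound hΩo hΩb (hfc n) (hfb n))
    intro s hs
    rw [lt_div_iff₀ hn] at hs
    simp only [φ, truncId]
    rw [bump_eq_zero]
    · simp
    · rw [abs_mul, abs_of_pos hn, mul_comm]
      exact hs.le
  have hlim := tendsto_setIntegral_of_bound hΩo hΩb hfc hfb
    (g := fun x => u x * dive F x + fderiv ℝ u x (F x)) (by
      filter_upwards [ae_fderiv_eq_zero hΩo hu] with x hx hxΩ
      -- On {u = 0} the approximants are zero, and so is the limit, since ∇u = 0 almost everywhere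
      -- there. Elsewhere the sequence is eventually constant.
      by_cases hux : u x = 0
      · have h0 : ∀ n, φ n 0 = 0 := fun n => by simp [φ, truncId]
        simp [f, hux, hx hxΩ hux, h0]
      · refine tendsto_const_nhds.congr' ?_
        filter_upwards [eventually_two_lt_abs_mul hux] with n hn
        have hn0 : ((n : ℝ) + 1) ≠ 0 := by positivity
        have h1 : φ n (u x) = u x := by
          simp only [φ, truncId, bump_eq_one hn.le, mul_one]
          exact mul_div_cancel_left₀ _ hn0
        simp only [f, (hφd n (u x)).deriv, deriv_truncId_eq_one hn, h1, one_mul])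
  simp only [hzero] at hlim
  exact (tendsto_nhds_unique hlim tendsto_const_nhds)

/-- A field that is tangent to the level sets of `u`, where `u` vanishes on the boundary, has no
net flux through the boundary. -/
theorem integral_dive_of_tangent {Ω : Set E3} (hΩo : IsOpen Ω) (hΩb : Bornology.IsBounded Ω)
    {u : E3 → ℝ} (huc : ContinuousOn u (closure Ω)) (hu0 : ∀ x ∈ frontier Ω, u x = 0)
    (hu : ContDiffOn ℝ 1 u Ω) {F : E3 → E3} (hF : DifferentiableOn ℝ F Ω)
    (hdc : ContinuousOn (dive F) Ω) {C : ℝ} (hdb : ∀ x ∈ Ω, |dive F x| ≤ C)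
    (hperp : ∀ x ∈ Ω, fderiv ℝ u x (F x) = 0)
    (hz : ∀ x ∈ Ω, u x = 0 → fderiv ℝ u x = 0 → dive F x = 0) :
    ∫ x in Ω, dive F x = 0 := by
  have hbd : Differentiable ℝ bump := contDiff_bump.differentiable (by simp)
  -- The derivatives of these cutoffs are not bounded in n; they are harmless because they only
  -- multiply ∇u · F = 0.
  let φ : ℕ → ℝ → ℝ := fun n s => bump (((n : ℝ) + 1) * s)
  have hφd : ∀ n, Differentiable ℝ (φ n) := fun n s =>
    (deriv_comp_const_mul hbd ((n : ℝ) + 1) s).differentiableAt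
  let f : ℕ → E3 → ℝ := fun n x => φ n (u x) * dive F x
  have hfc : ∀ n, ContinuousOn (f n) Ω := fun n =>
    ((hφd n).continuous.comp_continuousOn hu.continuousOn).mul hdc
  have hfb : ∀ n, ∀ x ∈ Ω, |f n x| ≤ C := fun n x hx => by
    simp only [f]
    rw [abs_mul]
    exact (mul_le_of_le_one_left (abs_nonneg _) (abs_bump_le _)).trans (hdb x hx)
  have heq : ∀ n, ∀ x ∈ Ω, φ n (u x) * dive F x + deriv (φ n) (u x) * fderiv ℝ u x (F x) = f n x :=
    fun n x hx => by rw [hperp x hx, mul_zero, add_zero]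
  have hzero : ∀ n, ∫ x in Ω, f n x = 0 := by
    intro n
    have hn : (0 : ℝ) < (n : ℝ) + 1 := by positivity
    rw [← setIntegral_congr_fun hΩo.measurableSet (heq n)]
    refine integral_cutoff_mul_dive hΩo hΩb huc hu0 (hu.differentiableOn (by simp)) hF
      (hφd n) (ε := 1 / ((n : ℝ) + 1)) (by positivity) ?_
      ((integrableOn_of_continuousOn_of_bound hΩo hΩb (hfc n) (hfb n)).congr_fun
        (fun x hx => (heq n x hx).symm) hΩo.measurableSet)
    intro s hs
    rw [lt_div_iff₀ hn] at hs
    refine bump_eq_zero ?_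
    rw [abs_mul, abs_of_pos hn, mul_comm]
    exact hs.le
  have hlim := tendsto_setIntegral_of_bound hΩo hΩb hfc hfb (g := dive F) (by
      filter_upwards [ae_fderiv_eq_zero hΩo hu] with x hx hxΩ
      by_cases hux : u x = 0
      · simp [f, hz x hxΩ hux (hx hxΩ hux)]
      · refine tendsto_const_nhds.congr' ?_
        filter_upwards [eventually_two_lt_abs_mul hux] with n hn
        simp only [f, φ, bump_eq_one hn.le, one_mul])
  simp only [hzero] at hlim
  exact (tendsto_nhds_unique hlim tendsto_const_nhds)

/-! ### Functions of class `Cⁿ` up to the boundary -/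

namespace ContDiffUpTo

variable {X Y Z : Type*} [NormedAddCommGroup X] [NormedSpace ℝ X] [NormedAddCommGroup Y]
  [NormedSpace ℝ Y] [NormedAddCommGroup Z] [NormedSpace ℝ Z] {n : ℕ} {s : Set X}

theorem contDiffOn {f : X → Y} (h : ContDiffUpTo n f s) : ContDiffOn ℝ n f s := by
  obtain ⟨_, p, hp, _⟩ := h
  exact HasFTaylorSeriesUpToOn.contDiffOn (n := n) hp

theorem clm_comp {f : X → Y} (h : ContDiffUpTo n f s) (L : Y →L[ℝ] Z) :
    ContDiffUpTo n (fun x => L (f x)) s := by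
  obtain ⟨hc, p, hp, hpc⟩ := h
  exact ⟨L.continuous.comp_continuousOn hc, _, hp.continuousLinearMap_comp L, fun m hm =>
    (ContinuousLinearMap.compContinuousMultilinearMapL ℝ (fun _ : Fin m => X) Y Z
      L).continuous.comp_continuousOn (hpc m hm)⟩

theorem prodMk {f : X → Y} {g : X → Z} (hf : ContDiffUpTo n f s) (hg : ContDiffUpTo n g s) :
    ContDiffUpTo n (fun x => (f x, g x)) s := by
  obtain ⟨hfc, p, hp, hpc⟩ := hf
  obtain ⟨hgc, q, hq, hqc⟩ := hg
  exact ⟨hfc.prodMk hgc, _, hp.prodMk hq, fun m hm =>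
    (ContinuousMultilinearMap.prodL ℝ (fun _ : Fin m => X) Y Z).continuous.comp_continuousOn
      ((hpc m hm).prodMk (hqc m hm))⟩

theorem add {f g : X → Y} (hf : ContDiffUpTo n f s) (hg : ContDiffUpTo n g s) :
    ContDiffUpTo n (fun x => f x + g x) s :=
  (hf.prodMk hg).clm_comp (ContinuousLinearMap.fst ℝ Y Y + ContinuousLinearMap.snd ℝ Y Y)

theorem sub {f g : X → Y} (hf : ContDiffUpTo n f s) (hg : ContDiffUpTo n g s) :
    ContDiffUpTo n (fun x => f x - g x) s :=
  (hf.prodMk hg).clm_comp (ContinuousLinearMap.fst ℝ Y Y - ContinuousLinearMap.snd ℝ Y Y)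

theorem const (c : Y) : ContDiffUpTo n (fun _ : X => c) s := by
  have h : HasFTaylorSeriesUpToOn n (fun _ : X => c) (ftaylorSeries ℝ fun _ : X => c) s :=
    (hasFTaylorSeriesUpToOn_univ_iff.2
      ((contDiff_const (n := n)).ftaylorSeries)).mono (subset_univ s)
  refine ⟨continuousOn_const, _, h, fun m hm => ?_⟩
  have := (contDiff_const (𝕜 := ℝ) (E := X) (c := c) (n := n)).continuous_iteratedFDeriv
    (m := m) (by exact_mod_cast hm)
  exact this.continuousOn

/-- The time set need not be open, so the given Taylor series itself is pulled back along the affine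
map x ↦ (t, x). -/
theorem slice {T : Set ℝ} {χ : ℝ → X → Y} (h : ContDiffUpTo n (Function.uncurry χ) (T ×ˢ s))
    {t : ℝ} (ht : t ∈ T) : ContDiffUpTo n (χ t) s := by
  obtain ⟨hc, p, hp, hpc⟩ := h
  let A : X →ᴬ[ℝ] ℝ × X :=
    (ContinuousAffineMap.const ℝ X ((t, 0) : ℝ × X)) +
      (ContinuousLinearMap.inr ℝ ℝ X).toContinuousAffineMap
  have hA : ∀ x, A x = (t, x) := fun x => by simp [A]
  have hAc : MapsTo A (closure s) (closure (T ×ˢ s)) := fun x hx => by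
    rw [hA, closure_prod_eq]
    exact ⟨subset_closure ht, hx⟩
  have hAs : s ⊆ A ⁻¹' (T ×ˢ s) := fun x hx => by
    rw [mem_preimage, hA]
    exact ⟨ht, hx⟩
  have hfA : χ t = Function.uncurry χ ∘ A := by
    ext x
    simp [hA]
  rw [hfA]
  refine ⟨hc.comp A.continuous.continuousOn hAc, _,
    (hp.comp_continuousAffineMap A).mono hAs, fun m hm => ?_⟩
  exact (isBoundedLinearMap_continuousMultilinearMap_comp_linear (ι := Fin m)
    A.contLinear).continuous.comp_continuousOn ((hpc m hm).comp A.continuous.continuousOn hAc)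

/-- On an open set the Taylor series is the sequence of iterated derivatives, and its terms are
continuous on the compact closure. -/
theorem exists_iteratedFDeriv_bound [ProperSpace X] {f : X → Y} (h : ContDiffUpTo n f s)
    (hs : IsOpen s) (hb : Bornology.IsBounded s) {m : ℕ} (hm : m ≤ n) :
    ∃ C, ∀ x ∈ s, ‖iteratedFDeriv ℝ m f x‖ ≤ C := by
  obtain ⟨_, p, hp, hpc⟩ := h
  obtain ⟨C, hC⟩ := hb.isCompact_closure.exists_bound_of_continuousOn (hpc m hm)
  refine ⟨C, fun x hx => ?_⟩
  rw [← iteratedFDerivWithin_of_isOpen m hs hx,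
    ← hp.eq_iteratedFDerivWithin_of_uniqueDiffOn (by exact_mod_cast hm) hs.uniqueDiffOn hx]
  exact hC x (subset_closure hx)

end ContDiffUpTo

/-- `C¹` functions on `Ω` that are bounded with bounded derivative. -/
structure BddC1 {Y : Type*} [NormedAddCommGroup Y] [NormedSpace ℝ Y] (Ω : Set E3) (f : E3 → Y) :
    Prop where
  contDiffOn : ContDiffOn ℝ 1 f Ω
  bound : ∃ C, ∀ x ∈ Ω, ‖f x‖ ≤ C ∧ ‖fderiv ℝ f x‖ ≤ C

namespace BddC1

variable {Y Z : Type*} [NormedAddCommGroup Y] [NormedSpace ℝ Y] [NormedAddCommGroup Z]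
  [NormedSpace ℝ Z] {Ω : Set E3}

theorem differentiableAt {f : E3 → Y} (h : BddC1 Ω f) (hΩ : IsOpen Ω) {x : E3} (hx : x ∈ Ω) :
    DifferentiableAt ℝ f x :=
  (h.contDiffOn.differentiableOn (by simp)).differentiableAt (hΩ.mem_nhds hx)

theorem of_contDiffUpTo {f : E3 → Y} {n : ℕ} (h : ContDiffUpTo n f Ω) (hn : 1 ≤ n) (hΩ : IsOpen Ω)
    (hb : Bornology.IsBounded Ω) : BddC1 Ω f := by
  obtain ⟨C, hC⟩ := h.exists_iteratedFDeriv_bound hΩ hb (m := 0) (by omega)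
  obtain ⟨D, hD⟩ := h.exists_iteratedFDeriv_bound hΩ hb hn
  refine ⟨h.contDiffOn.of_le (by exact_mod_cast hn), max C D, fun x hx => ⟨?_, ?_⟩⟩
  · simpa using (hC x hx).trans (le_max_left C D)
  · simpa using (hD x hx).trans (le_max_right C D)

theorem prodMk {f : E3 → Y} {g : E3 → Z} (hf : BddC1 Ω f) (hg : BddC1 Ω g) (hΩ : IsOpen Ω) :
    BddC1 Ω (fun x => (f x, g x)) := by
  obtain ⟨C, hC⟩ := hf.bound
  obtain ⟨D, hD⟩ := hg.bound
  refine ⟨hf.contDiffOn.prodMk hg.contDiffOn, max C D, fun x hx => ⟨?_, ?_⟩⟩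
  · rw [Prod.norm_def]
    exact max_le_max (hC x hx).1 (hD x hx).1
  · rw [((hf.differentiableAt hΩ hx).hasFDerivAt.prodMk
      (hg.differentiableAt hΩ hx).hasFDerivAt).fderiv, ContinuousLinearMap.opNorm_prod]
    exact max_le_max (hC x hx).2 (hD x hx).2

/-- The compact set K keeps the values of f away from the singularities of Ψ, so Ψ and its
derivative are bounded along f. -/
theorem comp {f : E3 → Y} (hf : BddC1 Ω f) (hΩ : IsOpen Ω) {O K : Set Y} (hO : IsOpen O)
    (hK : IsCompact K) (hKO : K ⊆ O) (hfK : ∀ x ∈ Ω, f x ∈ K) {Ψ : Y → Z}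
    (hΨ : ContDiffOn ℝ 1 Ψ O) : BddC1 Ω (fun x => Ψ (f x)) := by
  obtain ⟨C, hC⟩ := hf.bound
  obtain ⟨D, hD⟩ := hK.exists_bound_of_continuousOn (hΨ.continuousOn.mono hKO)
  obtain ⟨M, hM⟩ := hK.exists_bound_of_continuousOn
    ((hΨ.continuousOn_fderiv_of_isOpen hO (by simp)).mono hKO)
  refine ⟨hΨ.comp hf.contDiffOn fun x hx => hKO (hfK x hx), max D (M * C), fun x hx => ⟨?_, ?_⟩⟩
  · exact (hD _ (hfK x hx)).trans (le_max_left _ _)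
  · have hd : DifferentiableAt ℝ Ψ (f x) :=
      (hΨ.differentiableOn (by simp)).differentiableAt (hO.mem_nhds (hKO (hfK x hx)))
    have h : HasFDerivAt (fun x => Ψ (f x)) ((fderiv ℝ Ψ (f x)).comp (fderiv ℝ f x)) x :=
      hd.hasFDerivAt.comp x (hf.differentiableAt hΩ hx).hasFDerivAt
    rw [h.fderiv]
    refine le_max_of_le_right ((ContinuousLinearMap.opNorm_comp_le _ _).trans ?_)
    exact mul_le_mul (hM _ (hfK x hx)) (hC x hx).2 (norm_nonneg _)
      ((norm_nonneg _).trans (hM _ (hfK x hx)))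

theorem continuousOn_dive {F : E3 → E3} (hF : BddC1 Ω F) (hΩ : IsOpen Ω) :
    ContinuousOn (dive F) Ω := by
  have h := hF.contDiffOn.continuousOn_fderiv_of_isOpen hΩ (by simp)
  refine continuousOn_finsetSum _ fun i _ => ?_
  exact (EuclideanSpace.proj (𝕜 := ℝ) i : E3 →L[ℝ] ℝ).continuous.comp_continuousOn
    (h.clm_apply continuousOn_const)

theorem exists_dive_bound {F : E3 → E3} (hF : BddC1 Ω F) : ∃ C, ∀ x ∈ Ω, |dive F x| ≤ C := by
  obtain ⟨C, hC⟩ := hF.bound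
  refine ⟨∑ _i : Fin 3, C, fun x hx => (Finset.abs_sum_le_sum_abs _ _).trans
    (Finset.sum_le_sum fun i _ => ?_)⟩
  refine (PiLp.norm_apply_le (fderiv ℝ F x (EuclideanSpace.single i 1)) i).trans ?_
  refine ((fderiv ℝ F x).le_opNorm _).trans ?_
  simpa using (hC x hx).2

end BddC1

theorem bddC1_gradient {Ω : Set E3} {χ : E3 → ℝ} (h : ContDiffUpTo 2 χ Ω) (hΩ : IsOpen Ω)
    (hb : Bornology.IsBounded Ω) : BddC1 Ω (gradient χ) := by
  obtain ⟨C, hC⟩ := h.exists_iteratedFDeriv_bound hΩ hb (m := 1) (by omega)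
  obtain ⟨D, hD⟩ := h.exists_iteratedFDeriv_bound hΩ hb (m := 2) le_rfl
  have hf : BddC1 Ω (fderiv ℝ χ) := by
    refine ⟨h.contDiffOn.fderiv_of_isOpen hΩ (by norm_num), max C D, fun x hx => ⟨?_, ?_⟩⟩
    · simpa using (hC x hx).trans (le_max_left C D)
    · have := (hD x hx).trans (le_max_right C D)
      rw [← norm_iteratedFDeriv_fderiv] at this
      simpa using this
  obtain ⟨M, hM⟩ := hf.bound
  exact hf.comp hΩ isOpen_univ (isCompact_closedBall (0 : E3 →L[ℝ] ℝ) M) (subset_univ _)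
    (fun x hx => mem_closedBall_zero_iff.2 (hM x hx).1)
    ((InnerProductSpace.toDual ℝ E3).symm.toContinuousLinearEquiv.contDiff.contDiffOn)

/-- The standing assumptions on the domain, the density and the magnetic field. -/
structure Background (Ω : Set E3) (Ae : E3 → ℝ) (B : E3 → E3) : Prop where
  isOpen : IsOpen Ω
  bounded : Bornology.IsBounded Ω
  Ae_reg : ContDiffUpTo 2 Ae Ω
  B_reg : ContDiffUpTo 2 B Ω
  Ae_pos : ∀ x ∈ closure Ω, 0 < Ae x
  B_pos : ∀ x ∈ closure Ω, 0 < ‖B x‖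

namespace Background

variable {Ω : Set E3} {Ae : E3 → ℝ} {B : E3 → E3}

/-- The vector fields in play, apart from the flux, are functions of (A_e, B, ∇χ) that are singular
only at B = 0. These data range over a compact set avoiding B = 0, so all of these fields are
treated at once. -/
theorem bddC1_comp (bg : Background Ω Ae B) {χ : E3 → ℝ} (h : ContDiffUpTo 2 χ Ω) {Ψ : ℝ × E3 × E3 → E3}
    (hΨ : ContDiffOn ℝ 1 Ψ {p | p.2.1 ≠ 0}) :
    BddC1 Ω (fun x => Ψ (Ae x, B x, gradient χ x)) := by
  have hg := bddC1_gradient h bg.isOpen bg.bounded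
  obtain ⟨C, hC⟩ := hg.bound
  have hd : BddC1 Ω (fun x => (Ae x, B x, gradient χ x)) :=
    (BddC1.of_contDiffUpTo bg.Ae_reg one_le_two bg.isOpen bg.bounded).prodMk
      ((BddC1.of_contDiffUpTo bg.B_reg one_le_two bg.isOpen bg.bounded).prodMk hg bg.isOpen)
      bg.isOpen
  have hK := bg.bounded.isCompact_closure
  refine hd.comp bg.isOpen
    (K := image Ae (closure Ω) ×ˢ image B (closure Ω) ×ˢ Metric.closedBall 0 C)
    ?_ ?_ ?_ ?_ hΨ
  · exact isOpen_ne_fun (continuous_fst.comp continuous_snd) continuous_const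
  · exact (hK.image_of_continuousOn bg.Ae_reg.1).prod
      ((hK.image_of_continuousOn bg.B_reg.1).prod (isCompact_closedBall _ _))
  · rintro ⟨a, b, g⟩ ⟨-, ⟨x, hx, rfl⟩, -⟩
    exact norm_pos_iff.1 (bg.B_pos x hx)
  · intro x hx
    exact ⟨mem_image_of_mem _ (subset_closure hx), mem_image_of_mem _ (subset_closure hx),
      mem_closedBall_zero_iff.2 (hC x hx).1⟩

end Background

theorem contDiffOn_inv_norm_sq :
    ContDiffOn ℝ 1 (fun p : ℝ × E3 × E3 => (‖p.2.1‖ ^ 2)⁻¹) {p | p.2.1 ≠ 0} := by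
  have h : ContDiff ℝ 1 (fun p : ℝ × E3 × E3 => ‖p.2.1‖ ^ 2) :=
    (contDiff_fst.comp contDiff_snd).norm_sq ℝ
  exact h.contDiffOn.inv fun p hp => pow_ne_zero 2 (norm_ne_zero_iff.2 hp)

theorem contDiff_cross_mid :
    ContDiff ℝ 1 (fun p : ℝ × E3 × E3 => cross p.2.1 p.2.2) :=
  contDiff_cross.comp contDiff_snd

/-! ### Bounded continuous functions on `Ω` -/

/-- Functions that are continuous and bounded on `Ω`. -/
structure BddCont (Ω : Set E3) (f : E3 → ℝ) : Prop where
  cont : ContinuousOn f Ω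
  bound : ∃ C, ∀ x ∈ Ω, |f x| ≤ C

namespace BddCont

variable {Ω : Set E3} {f g : E3 → ℝ}

theorem const (c : ℝ) : BddCont Ω fun _ => c := ⟨continuousOn_const, |c|, fun _ _ => le_rfl⟩

theorem add (hf : BddCont Ω f) (hg : BddCont Ω g) : BddCont Ω fun x => f x + g x := by
  obtain ⟨C, hC⟩ := hf.bound
  obtain ⟨D, hD⟩ := hg.bound
  exact ⟨hf.cont.add hg.cont, C + D, fun x hx =>
    (abs_add_le _ _).trans (add_le_add (hC x hx) (hD x hx))⟩

theorem mul (hf : BddCont Ω f) (hg : BddCont Ω g) : BddCont Ω fun x => f x * g x := by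
  obtain ⟨C, hC⟩ := hf.bound
  obtain ⟨D, hD⟩ := hg.bound
  refine ⟨hf.cont.mul hg.cont, C * D, fun x hx => ?_⟩
  rw [abs_mul]
  exact mul_le_mul (hC x hx) (hD x hx) (abs_nonneg _) ((abs_nonneg _).trans (hC x hx))

theorem const_mul (c : ℝ) (hf : BddCont Ω f) : BddCont Ω fun x => c * f x := (const c).mul hf

theorem neg (hf : BddCont Ω f) : BddCont Ω fun x => -f x := by
  simpa using hf.const_mul (-1)

theorem sub (hf : BddCont Ω f) (hg : BddCont Ω g) : BddCont Ω fun x => f x - g x := by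
  simpa [sub_eq_add_neg] using hf.add hg.neg

theorem congr (hf : BddCont Ω f) (h : ∀ x ∈ Ω, g x = f x) : BddCont Ω g := by
  obtain ⟨C, hC⟩ := hf.bound
  exact ⟨hf.cont.congr h, C, fun x hx => by rw [h x hx]; exact hC x hx⟩

theorem comp (hf : BddCont Ω f) {φ : ℝ → ℝ} (hφ : Continuous φ) : BddCont Ω fun x => φ (f x) := by
  obtain ⟨C, hC⟩ := hf.bound
  obtain ⟨D, hD⟩ := (isCompact_Icc (a := -C) (b := C)).exists_bound_of_continuousOn hφ.continuousOn
  exact ⟨hφ.comp_continuousOn hf.cont, D, fun x hx => hD _ (abs_le.1 (hC x hx))⟩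

theorem of_continuousOn_closure (hf : ContinuousOn f (closure Ω)) (hb : Bornology.IsBounded Ω) :
    BddCont Ω f := by
  obtain ⟨C, hC⟩ := hb.isCompact_closure.exists_bound_of_continuousOn hf
  exact ⟨hf.mono subset_closure, C, fun x hx => hC x (subset_closure hx)⟩

theorem integrableOn (hf : BddCont Ω f) (hΩo : IsOpen Ω) (hΩb : Bornology.IsBounded Ω) :
    IntegrableOn f Ω := by
  obtain ⟨C, hC⟩ := hf.bound
  exact integrableOn_of_continuousOn_of_bound hΩo hΩb hf.cont hC

theorem inner {F G : E3 → E3} (hF : BddC1 Ω F) (hG : BddC1 Ω G) :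
    BddCont Ω fun x => inner ℝ (F x) (G x) := by
  obtain ⟨C, hC⟩ := hF.bound
  obtain ⟨D, hD⟩ := hG.bound
  refine ⟨hF.contDiffOn.continuousOn.inner hG.contDiffOn.continuousOn, C * D, fun x hx => ?_⟩
  exact (abs_real_inner_le_norm _ _).trans
    (mul_le_mul (hC x hx).1 (hD x hx).1 (norm_nonneg _) ((norm_nonneg _).trans (hC x hx).1))

theorem dive {F : E3 → E3} (hF : BddC1 Ω F) (hΩ : IsOpen Ω) : BddCont Ω (dive F) :=
  ⟨hF.continuousOn_dive hΩ, hF.exists_dive_bound⟩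

end BddCont

/-! ### The perpendicular gradient and the operator `𝒟` -/

theorem cross_cross_self (b g : E3) :
    cross b (cross b g) = inner ℝ b g • b - (‖b‖ ^ 2) • g := by
  rw [← real_inner_self_eq_norm_sq, inner_eq_sum, inner_eq_sum]
  refine ext_three ?_ ?_ ?_ <;> simp <;> ring

theorem gradPerp_eq {B : E3 → E3} {x : E3} (hB : 0 < ‖B x‖) (χ : E3 → ℝ) :
    gradPerp B χ x =
      gradient χ x - ((‖B x‖ ^ 2)⁻¹ * inner ℝ (B x) (gradient χ x)) • B x := by
  have h : ‖B x‖ ^ 2 ≠ 0 := by positivity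
  rw [gradPerp, cross_cross_self, smul_sub, smul_smul, smul_smul, inv_mul_cancel₀ h, one_smul]
  abel

/-- ∇_⊥ is the orthogonal projection of the gradient onto the plane normal to B. This is what makes
𝒟 symmetric. -/
theorem inner_gradient_gradPerp {B : E3 → E3} {x : E3} (hB : 0 < ‖B x‖) (f g : E3 → ℝ) :
    inner ℝ (gradient f x) (gradPerp B g x) = inner ℝ (gradPerp B f x) (gradPerp B g x) := by
  have h : inner ℝ (B x) (gradPerp B g x) = 0 := by
    rw [gradPerp_eq hB, inner_sub_right, real_inner_smul_right, real_inner_self_eq_norm_sq]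
    field_simp
    ring
  conv_rhs => rw [gradPerp_eq hB f]
  rw [inner_sub_left, real_inner_smul_left, h, mul_zero, sub_zero]

theorem gradient_add_mul {f g : E3 → ℝ} {x : E3} (hf : DifferentiableAt ℝ f x)
    (hg : DifferentiableAt ℝ g x) (s : ℝ) :
    gradient (fun y => f y + s * g y) x = gradient f x + s • gradient g x := by
  have h : fderiv ℝ (fun y => f y + s * g y) x = fderiv ℝ f x + s • fderiv ℝ g x :=
    (hf.hasFDerivAt.fun_add (hg.hasFDerivAt.const_mul s)).fderiv
  simp [gradient, h]

theorem gradPerp_add_mul (B : E3 → E3) {f g : E3 → ℝ} {x : E3} (hf : DifferentiableAt ℝ f x)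
    (hg : DifferentiableAt ℝ g x) (s : ℝ) :
    gradPerp B (fun y => f y + s * g y) x = gradPerp B f x + s • gradPerp B g x := by
  simp only [gradPerp, gradient_add_mul hf hg, cross_add_right, cross_smul_right, smul_add,
    neg_add, smul_neg]
  rw [smul_comm]

/-- The field `A_e ∇_⊥ χ / B²` whose divergence enters `𝒟`. -/
def perpField (Ae : E3 → ℝ) (B : E3 → E3) (χ : E3 → ℝ) (y : E3) : E3 :=
  (Ae y / ‖B y‖ ^ 2) • gradPerp B χ y

theorem opD_eq (lam σ : ℝ) (Ae : E3 → ℝ) (B : E3 → E3) (χ : E3 → ℝ) (x : E3) :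
    opD lam σ Ae B χ x = lam * Ae x * χ x - σ * dive (perpField Ae B χ) x := rfl

/-- The symmetric bilinear form of the energy. -/
def form (lam σ : ℝ) (Ω : Set E3) (Ae : E3 → ℝ) (B : E3 → E3) (f g : E3 → ℝ) : ℝ :=
  ∫ x in Ω, Ae x * (lam * (f x * g x) +
    σ * (inner ℝ (gradPerp B f x) (gradPerp B g x) / ‖B x‖ ^ 2))

theorem form_comm (lam σ : ℝ) (Ω : Set E3) (Ae : E3 → ℝ) (B : E3 → E3) (f g : E3 → ℝ) :
    form lam σ Ω Ae B f g = form lam σ Ω Ae B g f := by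
  simp only [form, mul_comm (f _), real_inner_comm]

namespace Background

variable {Ω : Set E3} {Ae : E3 → ℝ} {B : E3 → E3}

theorem B_pos' (bg : Background Ω Ae B) {x : E3} (hx : x ∈ Ω) : 0 < ‖B x‖ :=
  bg.B_pos x (subset_closure hx)

theorem Ae_pos' (bg : Background Ω Ae B) {x : E3} (hx : x ∈ Ω) : 0 < Ae x :=
  bg.Ae_pos x (subset_closure hx)

theorem differentiableAt (bg : Background Ω Ae B) {χ : E3 → ℝ} (h : ContDiffUpTo 2 χ Ω) {x : E3}
    (hx : x ∈ Ω) : DifferentiableAt ℝ χ x :=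
  (h.contDiffOn.differentiableOn (by simp)).differentiableAt (bg.isOpen.mem_nhds hx)

theorem bddCont (bg : Background Ω Ae B) {χ : E3 → ℝ} (h : ContDiffUpTo 2 χ Ω) : BddCont Ω χ :=
  .of_continuousOn_closure h.1 bg.bounded

theorem bddCont_inv_Ae (bg : Background Ω Ae B) : BddCont Ω fun x => (Ae x)⁻¹ :=
  .of_continuousOn_closure (bg.Ae_reg.1.inv₀ fun x hx => (bg.Ae_pos x hx).ne') bg.bounded

theorem bddCont_inv_B (bg : Background Ω Ae B) : BddCont Ω fun x => (‖B x‖ ^ 2)⁻¹ :=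
  .of_continuousOn_closure ((bg.B_reg.1.norm.pow 2).inv₀ fun x hx =>
    pow_ne_zero 2 (bg.B_pos x hx).ne') bg.bounded

theorem bddC1_gradPerp (bg : Background Ω Ae B) {χ : E3 → ℝ} (h : ContDiffUpTo 2 χ Ω) :
    BddC1 Ω (gradPerp B χ) :=
  bg.bddC1_comp h (Ψ := fun p => -((‖p.2.1‖ ^ 2)⁻¹ • cross p.2.1 (cross p.2.1 p.2.2)))
    (contDiffOn_inv_norm_sq.smul (contDiff_cross.comp
      ((contDiff_fst.comp contDiff_snd).prodMk contDiff_cross_mid)).contDiffOn).neg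

theorem bddC1_perpField (bg : Background Ω Ae B) {χ : E3 → ℝ} (h : ContDiffUpTo 2 χ Ω) :
    BddC1 Ω (perpField Ae B χ) :=
  bg.bddC1_comp h (Ψ := fun p => (p.1 / ‖p.2.1‖ ^ 2) •
      -((‖p.2.1‖ ^ 2)⁻¹ • cross p.2.1 (cross p.2.1 p.2.2)))
    ((contDiff_fst.contDiffOn.mul contDiffOn_inv_norm_sq).smul
      (contDiffOn_inv_norm_sq.smul (contDiff_cross.comp
        ((contDiff_fst.comp contDiff_snd).prodMk contDiff_cross_mid)).contDiffOn).neg)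

theorem bddC1_vE (bg : Background Ω Ae B) {χ : E3 → ℝ} (h : ContDiffUpTo 2 χ Ω) :
    BddC1 Ω (vE B χ) :=
  bg.bddC1_comp h (Ψ := fun p => (‖p.2.1‖ ^ 2)⁻¹ • cross p.2.1 p.2.2)
    (contDiffOn_inv_norm_sq.smul contDiff_cross_mid.contDiffOn)

theorem bddC1_Ae_vE (bg : Background Ω Ae B) {χ : E3 → ℝ} (h : ContDiffUpTo 2 χ Ω) :
    BddC1 Ω (fun x => Ae x • vE B χ x) :=
  bg.bddC1_comp h (Ψ := fun p => p.1 • (‖p.2.1‖ ^ 2)⁻¹ • cross p.2.1 p.2.2)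
    (contDiff_fst.contDiffOn.smul (contDiffOn_inv_norm_sq.smul contDiff_cross_mid.contDiffOn))

theorem bddC1_Ae_B (bg : Background Ω Ae B) :
    BddC1 Ω (fun x => (Ae x / ‖B x‖ ^ 2) • B x) :=
  bg.bddC1_comp (ContDiffUpTo.const 0) (Ψ := fun p => (p.1 / ‖p.2.1‖ ^ 2) • p.2.1)
    ((contDiff_fst.contDiffOn.mul contDiffOn_inv_norm_sq).smul
      (contDiff_fst.comp contDiff_snd).contDiffOn)

theorem bddCont_opD (bg : Background Ω Ae B) (lam σ : ℝ) {χ : E3 → ℝ} (h : ContDiffUpTo 2 χ Ω) :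
    BddCont Ω (opD lam σ Ae B χ) :=
  (((bg.bddCont bg.Ae_reg).const_mul lam).mul (bg.bddCont h)).sub
    ((BddCont.dive (bg.bddC1_perpField h) bg.isOpen).const_mul σ)

theorem bddCont_opD_div (bg : Background Ω Ae B) (lam σ : ℝ) {χ : E3 → ℝ}
    (h : ContDiffUpTo 2 χ Ω) : BddCont Ω (fun x => opD lam σ Ae B χ x / Ae x) :=
  (bg.bddCont_opD lam σ h).mul bg.bddCont_inv_Ae

theorem bddCont_form (bg : Background Ω Ae B) (lam σ : ℝ) {f g : E3 → ℝ}
    (hf : ContDiffUpTo 2 f Ω) (hg : ContDiffUpTo 2 g Ω) :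
    BddCont Ω fun x => Ae x * (lam * (f x * g x) +
      σ * (inner ℝ (gradPerp B f x) (gradPerp B g x) / ‖B x‖ ^ 2)) :=
  (bg.bddCont bg.Ae_reg).mul ((((bg.bddCont hf).mul (bg.bddCont hg)).const_mul lam).add
    (((BddCont.inner (bg.bddC1_gradPerp hf) (bg.bddC1_gradPerp hg)).mul
      bg.bddCont_inv_B).const_mul σ))

theorem opD_add_mul (bg : Background Ω Ae B) (lam σ : ℝ) {f g : E3 → ℝ}
    (hf : ContDiffUpTo 2 f Ω) (hg : ContDiffUpTo 2 g Ω) (s : ℝ) {x : E3} (hx : x ∈ Ω) :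
    opD lam σ Ae B (fun y => f y + s * g y) x =
      opD lam σ Ae B f x + s * opD lam σ Ae B g x := by
  have hev : perpField Ae B (fun y => f y + s * g y) =ᶠ[𝓝 x]
      fun y => perpField Ae B f y + s • perpField Ae B g y := by
    filter_upwards [bg.isOpen.mem_nhds hx] with y hy
    simp only [perpField, gradPerp_add_mul B (bg.differentiableAt hf hy)
      (bg.differentiableAt hg hy), smul_add]
    rw [smul_comm]
  have h1 := (bg.bddC1_perpField hf).differentiableAt bg.isOpen hx
  have h2 := (bg.bddC1_perpField hg).differentiableAt bg.isOpen hx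
  rw [opD_eq, opD_eq, opD_eq, dive_congr hev, dive_add h1 (h2.fun_const_smul s), dive_const_smul s h2]
  ring

theorem opD_const (lam σ : ℝ) (Ae : E3 → ℝ) (B : E3 → E3) (c : ℝ) (x : E3) :
    opD lam σ Ae B (fun _ => c) x = lam * Ae x * c := by
  have : perpField Ae B (fun _ => c) = fun _ => 0 := by
    ext y
    simp [perpField, gradPerp, gradient]
  rw [opD_eq, this]
  simp [GHM.dive, pd]

/-- Green's identity for `𝒟`. -/
theorem integral_mul_opD (bg : Background Ω Ae B) (lam σ : ℝ) {f g : E3 → ℝ}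
    (hf : ContDiffUpTo 2 f Ω) (hf0 : ∀ x ∈ frontier Ω, f x = 0) (hg : ContDiffUpTo 2 g Ω) :
    ∫ x in Ω, f x * opD lam σ Ae B g x = form lam σ Ω Ae B f g := by
  have hF := bg.bddC1_perpField hg
  have hfd : ∀ x, fderiv ℝ f x (perpField Ae B g x) =
      inner ℝ (gradient f x) (perpField Ae B g x) := fun x => fderiv_apply_eq_inner f x _
  have hd := BddCont.dive hF bg.isOpen
  have hi : BddCont Ω fun x => fderiv ℝ f x (perpField Ae B g x) := by
    simp only [hfd]
    exact .inner (bddC1_gradient hf bg.isOpen bg.bounded) hF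
  obtain ⟨C₁, h₁⟩ := hd.bound
  obtain ⟨C₂, h₂⟩ := hi.bound
  obtain ⟨C₃, h₃⟩ := (bg.bddCont hf).bound
  have key := integral_mul_dive_add bg.isOpen bg.bounded hf.1 hf0
    (hf.contDiffOn.of_le (by norm_num)) (hF.contDiffOn.differentiableOn (by simp)) hd.cont
    (C := max C₁ (max C₂ C₃)) (fun x hx => (h₁ x hx).trans (le_max_left _ _))
    (fun x hx => (h₃ x hx).trans (by simp)) (fun x hx => (h₂ x hx).trans (by simp))
  -- The λ-terms cancel, and what is left is σ times the divergence of f A_e ∇_⊥g / B², expanded by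
  -- the product rule.
  have hsum : form lam σ Ω Ae B f g - ∫ x in Ω, f x * opD lam σ Ae B g x =
      ∫ x in Ω, σ * (f x * GHM.dive (perpField Ae B g) x +
        fderiv ℝ f x (perpField Ae B g x)) := by
    rw [form, ← integral_sub ((bg.bddCont_form lam σ hf hg).integrableOn bg.isOpen bg.bounded)
      (((bg.bddCont hf).mul (bg.bddCont_opD lam σ hg)).integrableOn bg.isOpen bg.bounded)]
    refine setIntegral_congr_fun bg.isOpen.measurableSet fun x hx => ?_
    simp only [hfd, opD_eq]
    rw [perpField, real_inner_smul_right, inner_gradient_gradPerp (bg.B_pos' hx)]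
    ring
  rw [integral_const_mul, key, mul_zero] at hsum
  linarith

end Background

/-! ### The conservation laws at a fixed time -/

theorem inner_gradient_flux (σ : ℝ) (Ae : E3 → ℝ) (B : E3 → E3) (χ : E3 → ℝ) (x : E3) :
    inner ℝ (gradient χ x) (flux σ Ae B χ x) = 0 := by
  rw [flux, vE, real_inner_smul_right, real_inner_smul_right, inner_cross_right_self]
  simp

theorem gradient_add_const (χ : E3 → ℝ) (γ : ℝ) : gradient (fun y => χ y + γ) = gradient χ := by
  ext1 x
  simp [gradient]

namespace Background

variable {Ω : Set E3} {Ae : E3 → ℝ} {B : E3 → E3}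

/-- Energy conservation at a fixed time: integration by parts moves the derivative onto χ, and the
flux is perpendicular to ∇χ. -/
theorem integral_mul_dive_flux (bg : Background Ω Ae B) (σ γ : ℝ) {χ : E3 → ℝ}
    (h : ContDiffUpTo 2 χ Ω) (hbd : ∀ x ∈ frontier Ω, χ x + γ = 0)
    (hfl : DifferentiableOn ℝ (flux σ Ae B χ) Ω) (hdf : BddCont Ω (dive (flux σ Ae B χ))) :
    ∫ x in Ω, (χ x + γ) * dive (flux σ Ae B χ) x = 0 := by
  have hU : ContDiffUpTo 2 (fun x => χ x + γ) Ω := h.add (.const γ)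
  obtain ⟨C₁, h₁⟩ := hdf.bound
  obtain ⟨C₂, h₂⟩ := (bg.bddCont hU).bound
  have hz : ∀ x, fderiv ℝ (fun x => χ x + γ) x (flux σ Ae B χ x) = 0 := fun x => by
    rw [fderiv_apply_eq_inner, gradient_add_const, inner_gradient_flux]
  have key := integral_mul_dive_add bg.isOpen bg.bounded hU.1 hbd
    (hU.contDiffOn.of_le (by norm_num)) hfl hdf.cont
    (C := max C₁ C₂) (fun x hx => (h₁ x hx).trans (le_max_left _ _))
    (fun x hx => (h₂ x hx).trans (by simp)) (fun x hx => by
      rw [hz, abs_zero]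
      exact (abs_nonneg _).trans ((h₁ x hx).trans (le_max_left _ _)))
  simpa only [hz, add_zero] using key

theorem Ae_smul_vE (Ae : E3 → ℝ) (B : E3 → E3) (χ : E3 → ℝ) (x : E3) :
    Ae x • vE B χ x = cross ((Ae x / ‖B x‖ ^ 2) • B x) (gradient χ x) := by
  rw [vE, cross_smul_left, smul_smul, div_eq_mul_inv]

/-- The field is the cross product of A_e B / B² and ∇χ, both curl free. -/
theorem dive_Ae_smul_vE (bg : Background Ω Ae B) (hI : Integrability Ω Ae B) {χ : E3 → ℝ}
    (h : ContDiffUpTo 2 χ Ω) {x : E3} (hx : x ∈ Ω) : dive (fun y => Ae y • vE B χ y) x = 0 := by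
  simp only [Ae_smul_vE]
  rw [dive_cross (bg.bddC1_Ae_B.differentiableAt bg.isOpen hx)
    ((bddC1_gradient h bg.isOpen bg.bounded).differentiableAt bg.isOpen hx), hI x hx,
    curl_gradient (h.contDiffOn.contDiffAt (bg.isOpen.mem_nhds hx))]
  simp

/-- The field is -(A_e B / B²) × v_E; its first factor is curl free, so only the curl of v_E
survives. This identifies the vorticity term of the flux with the σ-part of 𝒟χ. -/
theorem dive_perpField (bg : Background Ω Ae B) (hI : Integrability Ω Ae B) {χ : E3 → ℝ}
    (h : ContDiffUpTo 2 χ Ω) {x : E3} (hx : x ∈ Ω) :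
    dive (perpField Ae B χ) x = Ae x * (inner ℝ (B x) (curl (vE B χ) x) / ‖B x‖ ^ 2) := by
  have hb := bg.bddC1_Ae_B.differentiableAt bg.isOpen hx
  have hv := (bg.bddC1_vE h).differentiableAt bg.isOpen hx
  have heq : perpField Ae B χ =
      fun y => (-1 : ℝ) • cross ((Ae y / ‖B y‖ ^ 2) • B y) (vE B χ y) := by
    ext1 y
    rw [perpField, gradPerp, vE, cross_smul_left, cross_smul_right]
    simp
  have hc : DifferentiableAt ℝ (fun y => cross ((Ae y / ‖B y‖ ^ 2) • B y) (vE B χ y)) x :=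
    ((contDiff_cross (n := 1)).differentiable (by simp)).differentiableAt.comp x (hb.prodMk hv)
  rw [heq, dive_const_smul _ hc, dive_cross hb hv, hI x hx, inner_zero_right,
    real_inner_smul_left]
  ring

/-- In the integrable case the flux is `(λχ - 1 - 𝒟χ / A_e) A_e v_E`. -/
theorem flux_eq (bg : Background Ω Ae B) (lam σ : ℝ) (hI : Integrability Ω Ae B) {χ : E3 → ℝ}
    (h : ContDiffUpTo 2 χ Ω) {x : E3} (hx : x ∈ Ω) :
    flux σ Ae B χ x =
      (lam * χ x - 1 - opD lam σ Ae B χ x / Ae x) • (Ae x • vE B χ x) := by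
  have hA := (bg.Ae_pos' hx).ne'
  rw [flux, smul_smul, opD_eq, bg.dive_perpField hI h hx]
  congr 1
  field_simp
  ring

/-- Enstrophy conservation at a fixed time: the integrand is -∇ · (w(q)V) with V = A_e v_E
divergence free and tangent to the level sets of χ + γ, which vanishes on the boundary. -/
theorem integral_deriv_mul_dive_flux (bg : Background Ω Ae B) (lam σ γ : ℝ)
    (hI : Integrability Ω Ae B) {χ : E3 → ℝ} (h : ContDiffUpTo 2 χ Ω)
    (hbd : ∀ x ∈ frontier Ω, χ x + γ = 0) (hfl : DifferentiableOn ℝ (flux σ Ae B χ) Ω)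
    (hdf : BddCont Ω (dive (flux σ Ae B χ))) {w : ℝ → ℝ} (hw : Differentiable ℝ w)
    (hw' : Continuous (deriv w)) :
    ∫ x in Ω, deriv w (opD lam σ Ae B χ x / Ae x) * dive (flux σ Ae B χ) x = 0 := by
  let q : E3 → ℝ := fun x => opD lam σ Ae B χ x / Ae x
  let V : E3 → E3 := fun x => Ae x • vE B χ x
  have hU : ContDiffUpTo 2 (fun x => χ x + γ) Ω := h.add (.const γ)
  have hq : BddCont Ω q := bg.bddCont_opD_div lam σ h
  have hqc : ∀ x ∈ Ω, ContinuousAt q x := fun x hx => hq.cont.continuousAt (bg.isOpen.mem_nhds hx)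
  have hV : ∀ x ∈ Ω, DifferentiableAt ℝ V x := fun x hx =>
    (bg.bddC1_Ae_vE h).differentiableAt bg.isOpen hx
  have hVdiv : ∀ x ∈ Ω, dive V x = 0 := fun x hx => bg.dive_Ae_smul_vE hI h hx
  have hχV : ∀ x, fderiv ℝ χ x (V x) = 0 := fun x => by
    rw [fderiv_apply_eq_inner]
    simp only [V, Ae_smul_vE, inner_cross_right_self]
  have hχd : ∀ x ∈ Ω, DifferentiableAt ℝ (fun y => lam * χ y - 1) x := fun x hx =>
    ((bg.differentiableAt h hx).const_mul lam).sub_const 1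
  -- Solving the flux formula for qV shows that qV is differentiable although q is only continuous.
  have hqV : ∀ x ∈ Ω, (fun y => q y • V y) =ᶠ[𝓝 x]
      fun y => (lam * χ y - 1) • V y + (-1 : ℝ) • flux σ Ae B χ y := fun x hx => by
    filter_upwards [bg.isOpen.mem_nhds hx] with y hy
    rw [bg.flux_eq lam σ hI h hy]
    change q y • V y = (lam * χ y - 1) • V y + (-1 : ℝ) • (lam * χ y - 1 - q y) • V y
    module
  have hfd : ∀ x ∈ Ω, DifferentiableAt ℝ (flux σ Ae B χ) x := fun x hx =>
    hfl.differentiableAt (bg.isOpen.mem_nhds hx)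
  have hqVd : ∀ x ∈ Ω, DifferentiableAt ℝ (fun y => q y • V y) x := fun x hx =>
    (((hχd x hx).fun_smul (hV x hx)).fun_add ((hfd x hx).fun_const_smul (-1 : ℝ))).congr_of_eventuallyEq
      (hqV x hx)
  have hqVdiv : ∀ x ∈ Ω, dive (fun y => q y • V y) x = -dive (flux σ Ae B χ) x := by
    intro x hx
    have h1 : fderiv ℝ (fun y => lam * χ y - 1) x = lam • fderiv ℝ χ x :=
      (((bg.differentiableAt h hx).hasFDerivAt.const_mul lam).sub_const 1).fderiv
    rw [dive_congr (hqV x hx), dive_add ((hχd x hx).fun_smul (hV x hx))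
      ((hfd x hx).fun_const_smul (-1 : ℝ)), dive_smul (hχd x hx) (hV x hx),
      dive_const_smul _ (hfd x hx), hVdiv x hx, h1]
    simp [hχV]
  have hmain := fun x (hx : x ∈ Ω) =>
    dive_comp_smul (hqc x hx) (hV x hx) (hqVd x hx) (hw (q x)) (hVdiv x hx)
  have hdiv : ∀ x ∈ Ω, dive (fun y => w (q y) • V y) x =
      -(deriv w (q x) * dive (flux σ Ae B χ) x) := fun x hx => by
    rw [(hmain x hx).2, hqVdiv x hx, mul_neg]
  have hb : BddCont Ω (dive fun y => w (q y) • V y) :=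
    ((hq.comp hw').mul hdf).neg.congr hdiv
  obtain ⟨C, hC⟩ := hb.bound
  have key := integral_dive_of_tangent bg.isOpen bg.bounded hU.1 hbd
    (hU.contDiffOn.of_le (by norm_num)) (F := fun y => w (q y) • V y)
    (fun x hx => (hmain x hx).1.differentiableWithinAt) hb.cont hC
    (fun x hx => by
      rw [map_smul, fderiv_add_const, hχV, smul_zero])
    -- At a critical point of χ, V vanishes, hence ∇ · (w(q)V) = w(q) ∇ · V = 0.
    (fun x hx _ hd => by
      have hV0 : V x = 0 := by
        rw [fderiv_add_const] at hd
        simp [V, vE, gradient, hd]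
      have h2 := hasFDerivAt_smul_of_eq_zero (c := fun y => w (q y))
        (ContinuousAt.comp (f := q) (hw _).continuousAt (hqc x hx)) (hV x hx).hasFDerivAt hV0
      have h3 := hVdiv x hx
      rw [dive_eq (hV x hx).hasFDerivAt] at h3
      rw [dive_eq h2]
      simp [← Finset.mul_sum, h3])
  rw [setIntegral_congr_fun bg.isOpen.measurableSet hdiv, integral_neg, neg_eq_zero] at key
  exact key

end Background

/-! ### Differentiation in time -/

theorem abs_slope_le {f f' : ℝ → ℝ} {T M : ℝ}
    (hf : ∀ s, 0 ≤ s → HasDerivWithinAt f (f' s) (Ici 0) s) (hM : ∀ s ∈ Icc 0 T, |f' s| ≤ M)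
    {s t : ℝ} (hs : s ∈ Icc 0 T) (ht : t ∈ Icc 0 T) : |f s - f t| ≤ M * |s - t| :=
  (convex_Icc 0 T).norm_image_sub_le_of_norm_hasDerivWithin_le
    (fun r hr => (hf r hr.1).mono Icc_subset_Ici_self) hM ht hs

/-- Dominated convergence: the mean value inequality bounds the difference quotients by M on [0, t +
1], a neighbourhood of t in [0, ∞). The weight k may move with s because the energy argument takes
it to be U_s + U_t. -/
theorem tendsto_integral_mul_slope {Ω : Set E3} (hΩo : IsOpen Ω) (hΩb : Bornology.IsBounded Ω)
    {k f f' : ℝ → E3 → ℝ} {t K M : ℝ} (ht : 0 ≤ t)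
    (hkc : ∀ s, 0 ≤ s → ContinuousOn (k s) Ω)
    (hkb : ∀ s ∈ Icc 0 (t + 1), ∀ x ∈ Ω, |k s x| ≤ K)
    (hkt : ∀ x ∈ Ω, ContinuousWithinAt (fun s => k s x) (Ici 0) t)
    (hfc : ∀ s, 0 ≤ s → ContinuousOn (f s) Ω)
    (hfd : ∀ s, 0 ≤ s → ∀ x ∈ Ω, HasDerivWithinAt (fun r => f r x) (f' s x) (Ici 0) s)
    (hfb : ∀ s ∈ Icc 0 (t + 1), ∀ x ∈ Ω, |f' s x| ≤ M) :
    Tendsto (fun s => ∫ x in Ω, k s x * slope (fun r => f r x) t s) (𝓝[Ici 0 \ {t}] t)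
      (𝓝 (∫ x in Ω, k t x * f' t x)) := by
  have hmem : ∀ᶠ s in 𝓝[Ici 0 \ {t}] t, s ∈ Icc 0 (t + 1) := by
    filter_upwards [self_mem_nhdsWithin, mem_nhdsWithin_of_mem_nhds (Iic_mem_nhds (lt_add_one t))]
      with s h1 h2
    exact ⟨h1.1, h2⟩
  have htm : t ∈ Icc 0 (t + 1) := ⟨ht, by linarith⟩
  refine tendsto_integral_filter_of_dominated_convergence (fun _ => K * M) ?_ ?_ ?_ ?_
  · filter_upwards [hmem] with s hs
    refine ContinuousOn.aestronglyMeasurable ?_ hΩo.measurableSet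
    simp only [slope, vsub_eq_sub, smul_eq_mul]
    exact (hkc s hs.1).mul (continuousOn_const.mul ((hfc s hs.1).sub (hfc t ht)))
  · filter_upwards [hmem, self_mem_nhdsWithin] with s hs hst
    rw [ae_restrict_iff' hΩo.measurableSet]
    refine Eventually.of_forall fun x hx => ?_
    have hne : 0 < |s - t| := abs_pos.2 (sub_ne_zero.2 hst.2)
    rw [norm_mul, Real.norm_eq_abs, Real.norm_eq_abs]
    refine mul_le_mul (hkb s hs x hx) ?_ (abs_nonneg _) ((abs_nonneg _).trans (hkb s hs x hx))
    rw [slope_def_field, abs_div, div_le_iff₀ hne]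
    exact abs_slope_le (fun r hr => hfd r hr x hx) (fun r hr => hfb r hr x hx) hs htm
  · exact integrableOn_const hΩb.measure_lt_top.ne
  · rw [ae_restrict_iff' hΩo.measurableSet]
    refine Eventually.of_forall fun x hx => ?_
    exact ((hkt x hx).tendsto.mono_left (nhdsWithin_mono t sdiff_subset)).mul
      (hasDerivWithinAt_iff_tendsto_slope.1 (hfd t ht x hx))

theorem hasDerivWithinAt_setIntegral {Ω : Set E3} (hΩo : IsOpen Ω) (hΩb : Bornology.IsBounded Ω)
    {f f' : ℝ → E3 → ℝ} {t M : ℝ} (ht : 0 ≤ t)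
    (hf : ∀ s, 0 ≤ s → BddCont Ω (f s))
    (hfd : ∀ s, 0 ≤ s → ∀ x ∈ Ω, HasDerivWithinAt (fun r => f r x) (f' s x) (Ici 0) s)
    (hfb : ∀ s ∈ Icc 0 (t + 1), ∀ x ∈ Ω, |f' s x| ≤ M) :
    HasDerivWithinAt (fun s => ∫ x in Ω, f s x) (∫ x in Ω, f' t x) (Ici 0) t := by
  rw [hasDerivWithinAt_iff_tendsto_slope]
  have h := tendsto_integral_mul_slope hΩo hΩb (k := fun _ _ => 1) (K := 1) ht
    (fun _ _ => continuousOn_const) (fun _ _ _ _ => by simp) (fun _ _ => continuousWithinAt_const)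
    (fun s hs => (hf s hs).cont) hfd hfb
  simp only [one_mul] at h
  refine h.congr' ?_
  filter_upwards [self_mem_nhdsWithin] with s hs
  simp only [slope, vsub_eq_sub, smul_eq_mul]
  rw [integral_const_mul, integral_sub ((hf s hs.1).integrableOn hΩo hΩb)
    ((hf t ht).integrableOn hΩo hΩb)]

theorem eq_initial_of_hasDerivWithinAt_zero {f : ℝ → ℝ}
    (h : ∀ t, 0 ≤ t → HasDerivWithinAt f 0 (Ici 0) t) {t : ℝ} (ht : 0 ≤ t) : f t = f 0 :=
  constant_of_has_deriv_right_zero (b := t)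
    (fun s hs => (h s hs.1).continuousWithinAt.mono Icc_subset_Ici_self)
    (fun s hs => (h s hs.1).mono (Ici_subset_Ici.2 hs.1)) t ⟨ht, le_rfl⟩

/-! ### The energy form -/

namespace Background

variable {Ω : Set E3} {Ae : E3 → ℝ} {B : E3 → E3}

theorem form_add_mul (bg : Background Ω Ae B) (lam σ : ℝ) {f g : E3 → ℝ}
    (hf : ContDiffUpTo 2 f Ω) (hg : ContDiffUpTo 2 g Ω) (s : ℝ) :
    form lam σ Ω Ae B (fun x => f x + s * g x) (fun x => f x + s * g x) =
      form lam σ Ω Ae B f f + 2 * s * form lam σ Ω Ae B f g + s ^ 2 * form lam σ Ω Ae B g g := by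
  have hff := (bg.bddCont_form lam σ hf hf).integrableOn bg.isOpen bg.bounded
  have hfg := (bg.bddCont_form lam σ hf hg).integrableOn bg.isOpen bg.bounded
  have hgg := (bg.bddCont_form lam σ hg hg).integrableOn bg.isOpen bg.bounded
  simp only [form]
  rw [← integral_const_mul, ← integral_const_mul, ← integral_add hff (hfg.const_mul _),
    ← integral_add (((bg.bddCont_form lam σ hf hf).add ((bg.bddCont_form lam σ hf hg).const_mul
      (2 * s))).integrableOn bg.isOpen bg.bounded) (hgg.const_mul _)]
  refine setIntegral_congr_fun bg.isOpen.measurableSet fun x hx => ?_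
  simp only [gradPerp_add_mul B (bg.differentiableAt hf hx) (bg.differentiableAt hg hx),
    inner_add_left, inner_add_right, real_inner_smul_left, real_inner_smul_right,
    real_inner_comm (gradPerp B f x) (gradPerp B g x)]
  ring

theorem energy_eq (lam σ : ℝ) (Ω : Set E3) (Ae : E3 → ℝ) (B : E3 → E3) (f : E3 → ℝ) :
    energy lam σ Ω Ae B f = 1 / 2 * form lam σ Ω Ae B f f := by
  simp only [energy, form, real_inner_self_eq_norm_sq, sq (f _)]

/-- The perpendicular gradient ignores constants, so shifting by γ produces exactly the first
variation of γM. -/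
theorem form_add_const_left (bg : Background Ω Ae B) (lam σ γ : ℝ) {f h : E3 → ℝ}
    (hf : ContDiffUpTo 2 f Ω) (hh : ContDiffUpTo 2 h Ω) :
    form lam σ Ω Ae B (fun x => f x + γ) h =
      form lam σ Ω Ae B f h + γ * (lam * ∫ x in Ω, Ae x * h x) := by
  have hfh := (bg.bddCont_form lam σ hf hh).integrableOn bg.isOpen bg.bounded
  have hAh := ((bg.bddCont bg.Ae_reg).mul (bg.bddCont hh)).integrableOn bg.isOpen bg.bounded
  simp only [form]
  rw [← integral_const_mul, ← integral_const_mul,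
    ← integral_add hfh ((hAh.const_mul lam).const_mul γ)]
  refine setIntegral_congr_fun bg.isOpen.measurableSet fun x hx => ?_
  simp only [gradPerp, gradient_add_const]
  ring

/-- The Euler–Lagrange identity at a critical point of the energy-Casimir functional. -/
theorem form_add_integral_eq_zero_of_isCritical (bg : Background Ω Ae B) {lam σ γ ν : ℝ}
    {w : ℝ → ℝ} (hw : ν = 0 ∨ Differentiable ℝ w ∧ Continuous (deriv w)) {χ₀ h : E3 → ℝ}
    (hχ₀ : ContDiffUpTo 2 χ₀ Ω) (hcrit : IsCritical lam σ Ω Ae B γ ν w χ₀)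
    (hh : ContDiffUpTo 2 h Ω) (hh0 : ∀ x ∈ frontier Ω, h x = 0) :
    form lam σ Ω Ae B (fun x => χ₀ x + γ) h +
      ν * ∫ x in Ω, deriv w (opD lam σ Ae B χ₀ x / Ae x) * opD lam σ Ae B h x = 0 := by
  -- One-sided derivatives suffice: they are unique at 0 on [0, ∞), the setting in which
  -- differentiation under the integral is available.
  have hE : HasDerivWithinAt (fun s : ℝ => energy lam σ Ω Ae B (fun x => χ₀ x + s * h x))
      (form lam σ Ω Ae B χ₀ h) (Ici 0) 0 := by
    simp only [energy_eq, bg.form_add_mul lam σ hχ₀ hh]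
    have h1 : HasDerivAt (fun s : ℝ => 1 / 2 * (form lam σ Ω Ae B χ₀ χ₀ +
        2 * s * form lam σ Ω Ae B χ₀ h + s ^ 2 * form lam σ Ω Ae B h h))
        (1 / 2 * (2 * 1 * form lam σ Ω Ae B χ₀ h +
          ((2 : ℕ) * (0 : ℝ) ^ 1 * 1) * form lam σ Ω Ae B h h)) 0 :=
      ((((((hasDerivAt_id (0 : ℝ)).const_mul 2).mul_const _).const_add _).add
        (((hasDerivAt_id (0 : ℝ)).pow 2).mul_const _)).const_mul _)
    refine (h1.congr_deriv ?_).hasDerivWithinAt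
    norm_num
    ring
  have hM : HasDerivWithinAt (fun s : ℝ => mass lam Ω Ae (fun x => χ₀ x + s * h x))
      (lam * ∫ x in Ω, Ae x * h x) (Ici 0) 0 := by
    have hA := bg.bddCont bg.Ae_reg
    have h1 : ∀ s : ℝ, mass lam Ω Ae (fun x => χ₀ x + s * h x) =
        mass lam Ω Ae χ₀ + s * (lam * ∫ x in Ω, Ae x * h x) := by
      intro s
      have i1 := (hA.mul ((BddCont.const 1).add ((bg.bddCont hχ₀).const_mul lam))).integrableOn
        bg.isOpen bg.bounded
      have i2 := (hA.mul (bg.bddCont hh)).integrableOn bg.isOpen bg.bounded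
      simp only [mass]
      rw [← integral_const_mul, ← integral_const_mul,
        ← integral_add i1 ((i2.const_mul lam).const_mul s)]
      refine setIntegral_congr_fun bg.isOpen.measurableSet fun x hx => ?_
      ring
    simp only [h1]
    have h2 := ((hasDerivAt_id (0 : ℝ)).mul_const (lam * ∫ x in Ω, Ae x * h x)).const_add
      (mass lam Ω Ae χ₀)
    rw [one_mul] at h2
    exact h2.hasDerivWithinAt
  have hW : HasDerivWithinAt
      (fun s : ℝ => ν * enstrophy lam σ Ω Ae B w (fun x => χ₀ x + s * h x))
      (ν * ∫ x in Ω, deriv w (opD lam σ Ae B χ₀ x / Ae x) * opD lam σ Ae B h x) (Ici 0) 0 := by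
    -- If ν = 0, nothing is assumed about w, and the zero factor removes the enstrophy.
    rcases hw with rfl | ⟨hwd, hwc⟩
    · simpa using hasDerivWithinAt_const (0 : ℝ) (Ici 0) (0 : ℝ)
    refine HasDerivWithinAt.const_mul ν ?_
    have hD₀ := bg.bddCont_opD lam σ hχ₀
    have hDh := bg.bddCont_opD lam σ hh
    let q : ℝ → E3 → ℝ := fun s x => (opD lam σ Ae B χ₀ x + s * opD lam σ Ae B h x) / Ae x
    have hq : ∀ s, BddCont Ω (q s) := fun s => (hD₀.add (hDh.const_mul s)).mul bg.bddCont_inv_Ae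
    have hens : ∀ s, enstrophy lam σ Ω Ae B w (fun x => χ₀ x + s * h x) =
        ∫ x in Ω, Ae x * w (q s x) := by
      intro s
      refine setIntegral_congr_fun bg.isOpen.measurableSet fun x hx => ?_
      simp only [q, bg.opD_add_mul lam σ hχ₀ hh s hx]
    simp only [hens]
    obtain ⟨C₀, hC₀⟩ := (hD₀.mul bg.bddCont_inv_Ae).bound
    obtain ⟨C₁, hC₁⟩ := (hDh.mul bg.bddCont_inv_Ae).bound
    obtain ⟨C₂, hC₂⟩ := hDh.bound
    -- For s in [0, 1] the argument of w' stays in this interval.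
    obtain ⟨R, hR⟩ := (isCompact_Icc (a := -(C₀ + C₁)) (b := C₀ + C₁)).exists_bound_of_continuousOn
      hwc.continuousOn
    have hmain := hasDerivWithinAt_setIntegral bg.isOpen bg.bounded (t := 0) (M := R * C₂)
      (f := fun s x => Ae x * w (q s x))
      (f' := fun s x => deriv w (q s x) * opD lam σ Ae B h x) le_rfl
      (fun s _ => (bg.bddCont bg.Ae_reg).mul ((hq s).comp hwd.continuous)) ?_ ?_
    · simpa [q] using hmain
    · intro s _ x hx
      have hA := (bg.Ae_pos' hx).ne'
      have h1 : HasDerivAt (fun r => q r x) (1 * opD lam σ Ae B h x / Ae x) s :=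
        (((hasDerivAt_id s).mul_const _).const_add _).div_const _
      have h2 := ((hwd (q s x)).hasDerivAt.comp s h1).const_mul (Ae x)
      refine (h2.congr_deriv ?_).hasDerivWithinAt
      field_simp
    · intro s hs x hx
      rw [abs_mul]
      have hs1 : |s| ≤ 1 := by
        rw [abs_of_nonneg hs.1]
        simpa using hs.2
      have hqb : |q s x| ≤ C₀ + C₁ := by
        have : q s x = opD lam σ Ae B χ₀ x * (Ae x)⁻¹ + s * (opD lam σ Ae B h x * (Ae x)⁻¹) := by
          simp only [q]
          ring
        rw [this]
        refine (abs_add_le _ _).trans (add_le_add (hC₀ x hx) ?_)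
        rw [abs_mul]
        exact (mul_le_of_le_one_left (abs_nonneg _) hs1).trans (hC₁ x hx)
      have hRb := hR _ (abs_le.1 hqb)
      exact mul_le_mul hRb (hC₂ x hx) (abs_nonneg _) ((norm_nonneg _).trans hRb)
  have htot := (hE.add (hM.const_mul γ)).add hW
  have hzero := (hcrit h hh hh0).hasDerivWithinAt (s := Ici 0)
  have := (uniqueDiffWithinAt_Ici (0 : ℝ)).eq_deriv _ htot hzero
  rw [bg.form_add_const_left lam σ γ hχ₀ hh]
  exact this

end Background

/-! ### Conserved quantities of a solution -/

namespace IsSolution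

variable {lam σ : ℝ} {Ω : Set E3} {Ae : E3 → ℝ} {B : E3 → E3} {χ : ℝ → E3 → ℝ}

theorem reg (sol : IsSolution lam σ Ω Ae B χ) {t : ℝ} (ht : 0 ≤ t) : ContDiffUpTo 2 (χ t) Ω :=
  sol.contDiff.slice ht

theorem isCompact_cylinder (bg : Background Ω Ae B) (T : ℝ) :
    IsCompact (Icc (0 : ℝ) T ×ˢ closure Ω) :=
  isCompact_Icc.prod bg.bounded.isCompact_closure

theorem exists_dive_flux_bound (sol : IsSolution lam σ Ω Ae B χ) (bg : Background Ω Ae B) (T : ℝ) :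
    ∃ M, ∀ s ∈ Icc 0 T, ∀ x ∈ Ω, |dive (flux σ Ae B (χ s)) x| ≤ M := by
  obtain ⟨g, hg, hgeq⟩ := sol.rhs_cont
  obtain ⟨M, hM⟩ := (isCompact_cylinder bg T).exists_bound_of_continuousOn
    (hg.mono (prod_mono Icc_subset_Ici_self subset_rfl))
  refine ⟨M, fun s hs x hx => ?_⟩
  rw [← hgeq s hs.1 x hx]
  exact hM (s, x) ⟨hs, subset_closure hx⟩

theorem bddCont_dive_flux (sol : IsSolution lam σ Ω Ae B χ) (bg : Background Ω Ae B) {t : ℝ}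
    (ht : 0 ≤ t) : BddCont Ω (dive (flux σ Ae B (χ t))) := by
  obtain ⟨M, hM⟩ := sol.exists_dive_flux_bound bg t
  obtain ⟨g, hg, hgeq⟩ := sol.rhs_cont
  refine ⟨?_, M, hM t ⟨ht, le_rfl⟩⟩
  have h1 : ContinuousOn (fun x => g (t, x)) Ω :=
    hg.comp (Continuous.prodMk_right t).continuousOn fun x hx => ⟨ht, subset_closure hx⟩
  exact h1.congr fun x hx => (hgeq t ht x hx).symm

theorem closure_cylinder : closure (Ici (0 : ℝ) ×ˢ Ω) = Ici 0 ×ˢ closure Ω := by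
  rw [closure_prod_eq, isClosed_Ici.closure_eq]

theorem exists_bound (sol : IsSolution lam σ Ω Ae B χ) (bg : Background Ω Ae B) (T : ℝ) :
    ∃ M, ∀ s ∈ Icc 0 T, ∀ x ∈ Ω, |χ s x| ≤ M := by
  have hc := sol.contDiff.1
  rw [closure_cylinder] at hc
  obtain ⟨M, hM⟩ := (isCompact_cylinder bg T).exists_bound_of_continuousOn
    (hc.mono (prod_mono Icc_subset_Ici_self subset_rfl))
  exact ⟨M, fun s hs x hx => hM (s, x) ⟨hs, subset_closure hx⟩⟩

theorem continuousWithinAt_time (sol : IsSolution lam σ Ω Ae B χ) {t : ℝ} (ht : 0 ≤ t) {x : E3}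
    (hx : x ∈ Ω) : ContinuousWithinAt (fun s => χ s x) (Ici 0) t := by
  have hc := sol.contDiff.1
  rw [closure_cylinder] at hc
  have h1 : ContinuousOn (fun s => Function.uncurry χ (s, x)) (Ici 0) :=
    hc.comp (Continuous.prodMk_left x).continuousOn fun s hs => ⟨hs, subset_closure hx⟩
  exact h1 t ht

/-- Conservation of energy. -/
theorem form_eq_initial (sol : IsSolution lam σ Ω Ae B χ) (bg : Background Ω Ae B) {γ : ℝ}
    (hbd : ∀ t, 0 ≤ t → ∀ x ∈ frontier Ω, χ t x + γ = 0) {t : ℝ} (ht : 0 ≤ t) :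
    form lam σ Ω Ae B (fun x => χ t x + γ) (fun x => χ t x + γ) =
      form lam σ Ω Ae B (fun x => χ 0 x + γ) (fun x => χ 0 x + γ) := by
  let U : ℝ → E3 → ℝ := fun t x => χ t x + γ
  refine eq_initial_of_hasDerivWithinAt_zero (f := fun t => form lam σ Ω Ae B (U t) (U t)) ?_ ht
  intro t ht
  have hU : ∀ s, 0 ≤ s → ContDiffUpTo 2 (U s) Ω := fun s hs => (sol.reg hs).add (.const γ)
  -- The shift by γ changes 𝒟χ by a term independent of time, so U obeys the same evolution.
  have hD : ∀ s, 0 ≤ s → ∀ x ∈ Ω, opD lam σ Ae B (U s) x =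
      opD lam σ Ae B (χ s) x + lam * Ae x * γ := by
    intro s hs x hx
    have h1 := bg.opD_add_mul lam σ (sol.reg hs) (ContDiffUpTo.const γ) 1 hx
    simp only [one_mul] at h1
    rw [h1, Background.opD_const]
  obtain ⟨M, hM⟩ := sol.exists_dive_flux_bound bg (t + 1)
  obtain ⟨K, hK⟩ := sol.exists_bound bg (t + 1)
  have htm : t ∈ Icc 0 (t + 1) := ⟨ht, by linarith⟩
  rw [hasDerivWithinAt_iff_tendsto_slope]
  have hlim := tendsto_integral_mul_slope bg.isOpen bg.bounded ht
    (k := fun s x => U s x + U t x) (f := fun s x => opD lam σ Ae B (χ s) x)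
    (f' := fun s x => dive (flux σ Ae B (χ s)) x) (K := (K + |γ|) + (K + |γ|)) (M := M)
    (fun s hs => ((bg.bddCont (hU s hs)).add (bg.bddCont (hU t ht))).cont)
    (fun s hs x hx => (abs_add_le _ _).trans (add_le_add
      ((abs_add_le _ _).trans (add_le_add (hK s hs x hx) le_rfl))
      ((abs_add_le _ _).trans (add_le_add (hK t htm x hx) le_rfl))))
    (fun x hx => ((sol.continuousWithinAt_time ht hx).add continuousWithinAt_const).add
      continuousWithinAt_const)
    (fun s hs => (bg.bddCont_opD lam σ (sol.reg hs)).cont) sol.equation hM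
  have hval : ∫ x in Ω, (U t x + U t x) * dive (flux σ Ae B (χ t)) x = 0 := by
    have h := bg.integral_mul_dive_flux σ γ (sol.reg ht) (hbd t ht) (sol.flux_diff t ht)
      (sol.bddCont_dive_flux bg ht)
    have h2 : ∀ x, (U t x + U t x) * dive (flux σ Ae B (χ t)) x =
        2 * ((χ t x + γ) * dive (flux σ Ae B (χ t)) x) := fun x => by simp only [U]; ring
    simp only [h2]
    rw [integral_const_mul, h, mul_zero]
  rw [hval] at hlim
  refine hlim.congr' ?_
  filter_upwards [self_mem_nhdsWithin] with s hs
  have hs0 : 0 ≤ s := hs.1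
  have hc : ∀ {a b : ℝ}, 0 ≤ a → 0 ≤ b →
      BddCont Ω (fun x => U a x * opD lam σ Ae B (U b) x) := fun ha hb =>
    (bg.bddCont (hU _ ha)).mul (bg.bddCont_opD lam σ (hU _ hb))
  have hi : ∀ {a b : ℝ}, 0 ≤ a → 0 ≤ b →
      IntegrableOn (fun x => U a x * opD lam σ Ae B (U b) x) Ω := fun ha hb =>
    (hc ha hb).integrableOn bg.isOpen bg.bounded
  have hG : ∀ {a b : ℝ}, 0 ≤ a → 0 ≤ b →
      ∫ x in Ω, U a x * opD lam σ Ae B (U b) x = form lam σ Ω Ae B (U a) (U b) := fun ha hb =>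
    bg.integral_mul_opD lam σ (hU _ ha) (hbd _ ha) (hU _ hb)
  -- By Green's identity and symmetry the cross terms cancel, as in a² - b² = (a + b)(a - b). Only
  -- 𝒟χ is then differentiated in time, which is what the equation provides.
  have hdiff : form lam σ Ω Ae B (U s) (U s) - form lam σ Ω Ae B (U t) (U t) =
      ∫ x in Ω, (U s x + U t x) * (opD lam σ Ae B (χ s) x - opD lam σ Ae B (χ t) x) := by
    have h1 : ∫ x in Ω, ((U s x * opD lam σ Ae B (U s) x + U t x * opD lam σ Ae B (U s) x) -
        (U s x * opD lam σ Ae B (U t) x + U t x * opD lam σ Ae B (U t) x)) =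
        form lam σ Ω Ae B (U s) (U s) - form lam σ Ω Ae B (U t) (U t) := by
      rw [integral_sub (((hc hs0 hs0).add (hc ht hs0)).integrableOn bg.isOpen bg.bounded)
        (((hc hs0 ht).add (hc ht ht)).integrableOn bg.isOpen bg.bounded),
        integral_add (hi hs0 hs0) (hi ht hs0), integral_add (hi hs0 ht) (hi ht ht), hG hs0 hs0,
        hG ht hs0, hG hs0 ht, hG ht ht, form_comm lam σ Ω Ae B (U t) (U s)]
      ring
    rw [← h1]
    refine setIntegral_congr_fun bg.isOpen.measurableSet fun x hx => ?_
    simp only [hD s hs0 x hx, hD t ht x hx]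
    ring
  rw [slope_def_field, hdiff, div_eq_inv_mul, ← integral_const_mul]
  refine setIntegral_congr_fun bg.isOpen.measurableSet fun x hx => ?_
  simp only [slope_def_field]
  ring

/-- Conservation of the generalized enstrophy in the integrable case. -/
theorem enstrophy_eq_initial (sol : IsSolution lam σ Ω Ae B χ) (bg : Background Ω Ae B)
    (hI : Integrability Ω Ae B) {γ : ℝ} (hbd : ∀ t, 0 ≤ t → ∀ x ∈ frontier Ω, χ t x + γ = 0)
    {w : ℝ → ℝ} (hw : Differentiable ℝ w) (hw' : Continuous (deriv w)) {t : ℝ} (ht : 0 ≤ t) :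
    enstrophy lam σ Ω Ae B w (χ t) = enstrophy lam σ Ω Ae B w (χ 0) := by
  refine eq_initial_of_hasDerivWithinAt_zero
    (f := fun t => enstrophy lam σ Ω Ae B w (χ t)) ?_ ht
  intro t ht
  obtain ⟨M, hM⟩ := sol.exists_dive_flux_bound bg (t + 1)
  obtain ⟨C₀, hC₀⟩ := (bg.bddCont_opD lam σ (sol.reg le_rfl)).bound
  obtain ⟨C₁, hC₁⟩ := bg.bddCont_inv_Ae.bound
  -- The equation bounds the growth of 𝒟χ from its initial size C₀ by M per unit time; C₁ bounds 1 /
  -- A_e.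
  have hqb : ∀ s ∈ Icc 0 (t + 1), ∀ x ∈ Ω,
      |opD lam σ Ae B (χ s) x / Ae x| ≤ (C₀ + M * (t + 1)) * C₁ := by
    intro s hs x hx
    have hM0 : 0 ≤ M := (abs_nonneg _).trans (hM s hs x hx)
    have h1 := abs_slope_le (f := fun r => opD lam σ Ae B (χ r) x)
      (f' := fun r => dive (flux σ Ae B (χ r)) x) (fun r hr => sol.equation r hr x hx)
      (fun r hr => hM r hr x hx) hs ⟨le_rfl, by linarith⟩
    have h2 : |opD lam σ Ae B (χ s) x| ≤ C₀ + M * (t + 1) := by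
      have h3 := abs_sub_abs_le_abs_sub (opD lam σ Ae B (χ s) x) (opD lam σ Ae B (χ 0) x)
      have h4 : M * |s - 0| ≤ M * (t + 1) := by
        refine mul_le_mul_of_nonneg_left ?_ hM0
        rw [sub_zero, abs_of_nonneg hs.1]
        exact hs.2
      have h5 := hC₀ x hx
      linarith
    rw [div_eq_mul_inv, abs_mul]
    exact mul_le_mul h2 (hC₁ x hx) (abs_nonneg _) ((abs_nonneg _).trans h2)
  obtain ⟨R, hR⟩ := (isCompact_Icc (a := -((C₀ + M * (t + 1)) * C₁))
    (b := (C₀ + M * (t + 1)) * C₁)).exists_bound_of_continuousOn hw'.continuousOn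
  have hmain := hasDerivWithinAt_setIntegral bg.isOpen bg.bounded (t := t) (M := R * M)
    (f := fun s x => Ae x * w (opD lam σ Ae B (χ s) x / Ae x))
    (f' := fun s x => deriv w (opD lam σ Ae B (χ s) x / Ae x) * dive (flux σ Ae B (χ s)) x) ht
    (fun s hs => (bg.bddCont bg.Ae_reg).mul
      ((bg.bddCont_opD_div lam σ (sol.reg hs)).comp hw.continuous)) ?_ ?_
  · rwa [bg.integral_deriv_mul_dive_flux lam σ γ hI (sol.reg ht) (hbd t ht) (sol.flux_diff t ht)
      (sol.bddCont_dive_flux bg ht) hw hw'] at hmain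
  · intro s hs x hx
    have hA := (bg.Ae_pos' hx).ne'
    have h1 := ((hw (opD lam σ Ae B (χ s) x / Ae x)).hasDerivAt.comp_hasDerivWithinAt s
      ((sol.equation s hs x hx).div_const (Ae x))).const_mul (Ae x)
    refine h1.congr_deriv ?_
    field_simp
  · intro s hs x hx
    have hRb := hR _ (abs_le.1 (hqb s hs x hx))
    rw [abs_mul]
    exact mul_le_mul hRb (hM s hs x hx) (abs_nonneg _) ((norm_nonneg _).trans hRb)

end IsSolution

/-! ### Convexity and norm equivalence -/

theorem tangent_line_le {g : ℝ → ℝ} (hg : Differentiable ℝ g) (hg' : Differentiable ℝ (deriv g))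
    (hpos : ∀ s, 0 ≤ deriv (deriv g) s) (x y : ℝ) : g x + deriv g x * (y - x) ≤ g y := by
  have hmono : Monotone (deriv g) := monotone_of_deriv_nonneg hg' hpos
  rcases lt_trichotomy x y with h | rfl | h
  · obtain ⟨c, hc, hceq⟩ := exists_deriv_eq_slope g h hg.continuous.continuousOn
      hg.differentiableOn
    have h1 := hmono hc.1.le
    rw [hceq, le_div_iff₀ (sub_pos.2 h)] at h1
    linarith
  · simp
  · obtain ⟨c, hc, hceq⟩ := exists_deriv_eq_slope g h hg.continuous.continuousOn
      hg.differentiableOn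
    have h1 := hmono hc.2.le
    rw [hceq, div_le_iff₀ (sub_pos.2 h)] at h1
    linarith

/-- Subtracting c s² / 2 leaves a convex function, which lies above its tangents. The second
derivative need not be continuous and c may be negative. -/
theorem quadratic_le_of_le_second_deriv {g : ℝ → ℝ} {c : ℝ} (hg : Differentiable ℝ g)
    (hg' : Differentiable ℝ (deriv g)) (hc : ∀ s, c ≤ deriv (deriv g) s) (x y : ℝ) :
    c / 2 * (y - x) ^ 2 ≤ g y - g x - deriv g x * (y - x) := by
  have h1 : ∀ s, HasDerivAt (fun s => g s - c / 2 * s ^ 2) (deriv g s - c * s) s := fun s => by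
    have h := (hg s).hasDerivAt.sub (((hasDerivAt_id s).pow 2).const_mul (c / 2))
    refine h.congr_deriv ?_
    simp
    ring
  have h2 : deriv (fun s => g s - c / 2 * s ^ 2) = fun s => deriv g s - c * s :=
    funext fun s => (h1 s).deriv
  have h3 : ∀ s, HasDerivAt (fun s => deriv g s - c * s) (deriv (deriv g) s - c * 1) s := fun s =>
    (hg' s).hasDerivAt.sub ((hasDerivAt_id s).const_mul c)
  have h4 := tangent_line_le (fun s => (h1 s).differentiableAt)
    (by rw [h2]; exact fun s => (h3 s).differentiableAt)
    (fun s => by rw [h2, (h3 s).deriv]; linarith [hc s]) x y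
  rw [h2] at h4
  simp only at h4
  linarith

theorem exists_pos_bounds {Ω : Set E3} (hΩ : Bornology.IsBounded Ω) {f : E3 → ℝ}
    (hf : ContinuousOn f (closure Ω)) (hpos : ∀ x ∈ closure Ω, 0 < f x) :
    ∃ m M, 0 < m ∧ 0 < M ∧ ∀ x ∈ Ω, m ≤ f x ∧ f x ≤ M := by
  obtain ⟨C, hC⟩ := (BddCont.of_continuousOn_closure hf hΩ).bound
  obtain ⟨D, hD⟩ := (BddCont.of_continuousOn_closure
    (hf.inv₀ fun x hx => (hpos x hx).ne') hΩ).bound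
  -- The maxima with 1 keep both constants positive even when Ω is empty.
  have hD1 : 0 < max D 1 := lt_max_of_lt_right one_pos
  refine ⟨(max D 1)⁻¹, max C 1, inv_pos.2 hD1, lt_max_of_lt_right one_pos, fun x hx => ⟨?_, ?_⟩⟩
  · have h0 := hpos x (subset_closure hx)
    rw [inv_le_comm₀ hD1 h0]
    exact ((le_abs_self _).trans (hD x hx)).trans (le_max_left _ _)
  · exact ((le_abs_self _).trans (hC x hx)).trans (le_max_left _ _)

namespace Background

variable {Ω : Set E3} {Ae : E3 → ℝ} {B : E3 → E3}

theorem exists_form_bounds (bg : Background Ω Ae B) {lam σ : ℝ} (hlam : 0 < lam) (hσ : 0 < σ) :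
    ∃ c C, 0 < c ∧ 0 < C ∧ ∀ u, ContDiffUpTo 2 u Ω →
      c * ((∫ x in Ω, u x ^ 2) + ∫ x in Ω, ‖gradPerp B u x‖ ^ 2) ≤ form lam σ Ω Ae B u u ∧
      form lam σ Ω Ae B u u ≤ C * ((∫ x in Ω, u x ^ 2) + ∫ x in Ω, ‖gradPerp B u x‖ ^ 2) := by
  obtain ⟨a, A, ha, hA, hAe⟩ := exists_pos_bounds bg.bounded bg.Ae_reg.1 bg.Ae_pos
  obtain ⟨b, b', hb, hb', hB⟩ := exists_pos_bounds bg.bounded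
    ((bg.B_reg.1.norm.pow 2).inv₀ fun x hx => pow_ne_zero 2 (bg.B_pos x hx).ne')
    (fun x hx => inv_pos.2 (pow_pos (bg.B_pos x hx) 2))
  -- Here a, A bound A_e and b, b' bound 1 / B²; the comparison of the integrands is pointwise.
  refine ⟨a * min lam (σ * b), A * max lam (σ * b'), by positivity, by positivity, fun u hu => ?_⟩
  have hu2 : BddCont Ω fun x => u x ^ 2 := (bg.bddCont hu).comp (continuous_pow 2)
  have hg2 : BddCont Ω fun x => ‖gradPerp B u x‖ ^ 2 := by
    simp only [← real_inner_self_eq_norm_sq]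
    exact .inner (bg.bddC1_gradPerp hu) (bg.bddC1_gradPerp hu)
  have hS := (hu2.add hg2)
  have hform := (bg.bddCont_form lam σ hu hu).integrableOn bg.isOpen bg.bounded
  rw [← integral_add (hu2.integrableOn bg.isOpen bg.bounded)
    (hg2.integrableOn bg.isOpen bg.bounded), ← integral_const_mul, ← integral_const_mul, form]
  constructor
  · refine setIntegral_mono_on ((hS.const_mul _).integrableOn bg.isOpen bg.bounded) hform
      bg.isOpen.measurableSet fun x hx => ?_
    rw [real_inner_self_eq_norm_sq, mul_assoc, ← sq (u x)]
    refine mul_le_mul (hAe x hx).1 ?_ (by positivity) (bg.Ae_pos' hx).le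
    rw [mul_add]
    refine add_le_add (mul_le_mul_of_nonneg_right (min_le_left _ _) (sq_nonneg _)) ?_
    have h1 : σ * (‖gradPerp B u x‖ ^ 2 / ‖B x‖ ^ 2) =
        (σ * (‖B x‖ ^ 2)⁻¹) * ‖gradPerp B u x‖ ^ 2 := by ring
    rw [h1]
    exact mul_le_mul_of_nonneg_right ((min_le_right _ _).trans
      (mul_le_mul_of_nonneg_left (hB x hx).1 hσ.le)) (sq_nonneg _)
  · refine setIntegral_mono_on hform ((hS.const_mul _).integrableOn bg.isOpen bg.bounded)
      bg.isOpen.measurableSet fun x hx => ?_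
    rw [real_inner_self_eq_norm_sq, mul_assoc, ← sq (u x)]
    refine mul_le_mul (hAe x hx).2 ?_ (by positivity) hA.le
    rw [mul_add]
    refine add_le_add (mul_le_mul_of_nonneg_right (le_max_left _ _) (sq_nonneg _)) ?_
    have h1 : σ * (‖gradPerp B u x‖ ^ 2 / ‖B x‖ ^ 2) =
        (σ * (‖B x‖ ^ 2)⁻¹) * ‖gradPerp B u x‖ ^ 2 := by ring
    rw [h1]
    exact mul_le_mul_of_nonneg_right ((mul_le_mul_of_nonneg_left (hB x hx).2 hσ.le).trans
      (le_max_right _ _)) (sq_nonneg _)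

/-! ### The second-order remainder of the enstrophy -/

theorem opD_sub (bg : Background Ω Ae B) (lam σ : ℝ) {f g : E3 → ℝ}
    (hf : ContDiffUpTo 2 f Ω) (hg : ContDiffUpTo 2 g Ω) {x : E3} (hx : x ∈ Ω) :
    opD lam σ Ae B (fun y => f y - g y) x = opD lam σ Ae B f x - opD lam σ Ae B g x := by
  have h := bg.opD_add_mul lam σ hf hg (-1) hx
  simpa [← sub_eq_add_neg] using h

/-- The part of the energy-Casimir functional beyond first order that comes from the enstrophy. -/
def casimirRemainder (lam σ : ℝ) (Ω : Set E3) (Ae : E3 → ℝ) (B : E3 → E3) (ν : ℝ) (w : ℝ → ℝ)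
    (χ₀ χ : E3 → ℝ) : ℝ :=
  ∫ x in Ω, Ae x * (ν * (w (opD lam σ Ae B χ x / Ae x) - w (opD lam σ Ae B χ₀ x / Ae x) -
    deriv w (opD lam σ Ae B χ₀ x / Ae x) *
      (opD lam σ Ae B χ x / Ae x - opD lam σ Ae B χ₀ x / Ae x)))

theorem bddCont_casimirRemainder (bg : Background Ω Ae B) (lam σ ν : ℝ) {w : ℝ → ℝ}
    (hw : Continuous w) (hw' : Continuous (deriv w)) {χ₀ χ : E3 → ℝ}
    (hχ₀ : ContDiffUpTo 2 χ₀ Ω) (hχ : ContDiffUpTo 2 χ Ω) :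
    BddCont Ω fun x => Ae x * (ν * (w (opD lam σ Ae B χ x / Ae x) -
      w (opD lam σ Ae B χ₀ x / Ae x) - deriv w (opD lam σ Ae B χ₀ x / Ae x) *
        (opD lam σ Ae B χ x / Ae x - opD lam σ Ae B χ₀ x / Ae x))) := by
  have hq := bg.bddCont_opD_div lam σ hχ
  have hq₀ := bg.bddCont_opD_div lam σ hχ₀
  exact (bg.bddCont bg.Ae_reg).mul
    ((((hq.comp hw).sub (hq₀.comp hw)).sub ((hq₀.comp hw').mul (hq.sub hq₀))).const_mul ν)

/-- A_e times the increment of q is 𝒟(χ - χ₀), so the linear term is the one in the Euler–Lagrange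
identity. -/
theorem casimirRemainder_eq (bg : Background Ω Ae B) (lam σ ν : ℝ) {w : ℝ → ℝ}
    (hw : Continuous w) (hw' : Continuous (deriv w)) {χ₀ χ : E3 → ℝ}
    (hχ₀ : ContDiffUpTo 2 χ₀ Ω) (hχ : ContDiffUpTo 2 χ Ω) :
    casimirRemainder lam σ Ω Ae B ν w χ₀ χ =
      ν * enstrophy lam σ Ω Ae B w χ - ν * enstrophy lam σ Ω Ae B w χ₀ -
        ν * ∫ x in Ω, deriv w (opD lam σ Ae B χ₀ x / Ae x) *
          opD lam σ Ae B (fun y => χ y - χ₀ y) x := by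
  have hq := bg.bddCont_opD_div lam σ hχ
  have hq₀ := bg.bddCont_opD_div lam σ hχ₀
  have hA := bg.bddCont bg.Ae_reg
  have h1 := (hA.mul (hq.comp hw)).const_mul ν
  have h2 := (hA.mul (hq₀.comp hw)).const_mul ν
  have h3 := ((hq₀.comp hw').mul (bg.bddCont_opD lam σ (hχ.sub hχ₀))).const_mul ν
  simp only [enstrophy]
  rw [← integral_const_mul, ← integral_const_mul, ← integral_const_mul,
    ← integral_sub (h1.integrableOn bg.isOpen bg.bounded) (h2.integrableOn bg.isOpen bg.bounded),
    ← integral_sub ((h1.sub h2).integrableOn bg.isOpen bg.bounded)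
      (h3.integrableOn bg.isOpen bg.bounded)]
  refine setIntegral_congr_fun bg.isOpen.measurableSet fun x hx => ?_
  have hne := (bg.Ae_pos' hx).ne'
  simp only [bg.opD_sub lam σ hχ hχ₀ hx]
  field_simp

theorem exists_casimirRemainder_bounds (bg : Background Ω Ae B) (lam σ : ℝ) {ν cm cM : ℝ}
    {w : ℝ → ℝ} (hw : Differentiable ℝ w) (hw' : Differentiable ℝ (deriv w)) (hcm : 0 < cm)
    (hb : ∀ s, cm ≤ ν * deriv (deriv w) s ∧ ν * deriv (deriv w) s ≤ cM) {χ₀ : E3 → ℝ}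
    (hχ₀ : ContDiffUpTo 2 χ₀ Ω) :
    ∃ c C, 0 < c ∧ 0 < C ∧ ∀ χ, ContDiffUpTo 2 χ Ω →
      c * (∫ x in Ω, opD lam σ Ae B (fun y => χ y - χ₀ y) x ^ 2) ≤
        casimirRemainder lam σ Ω Ae B ν w χ₀ χ ∧
      casimirRemainder lam σ Ω Ae B ν w χ₀ χ ≤
        C * ∫ x in Ω, opD lam σ Ae B (fun y => χ y - χ₀ y) x ^ 2 := by
  have hcM : 0 < cM := hcm.trans_le ((hb 0).1.trans (hb 0).2)
  have hlow : ∀ x y, cm / 2 * (y - x) ^ 2 ≤ ν * (w y - w x - deriv w x * (y - x)) := by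
    intro x y
    have hd : deriv (fun s => ν * w s) = fun s => ν * deriv w s :=
      funext fun s => deriv_const_mul_field ν
    have h := quadratic_le_of_le_second_deriv (g := fun s => ν * w s) (c := cm) (hw.const_mul ν)
      (by rw [hd]; exact hw'.const_mul ν)
      (fun s => by rw [hd, deriv_const_mul_field]; exact (hb s).1) x y
    rw [hd] at h
    linarith
  -- The upper bound is the lower bound applied to -νw, whose second derivative is at least -cM.
  have hup : ∀ x y, ν * (w y - w x - deriv w x * (y - x)) ≤ cM / 2 * (y - x) ^ 2 := by
    intro x y
    have hd : deriv (fun s => (-ν) * w s) = fun s => (-ν) * deriv w s :=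
      funext fun s => deriv_const_mul_field (-ν)
    have h := quadratic_le_of_le_second_deriv (g := fun s => (-ν) * w s) (c := -cM)
      (hw.const_mul (-ν)) (by rw [hd]; exact hw'.const_mul (-ν))
      (fun s => by rw [hd, deriv_const_mul_field]; linarith [(hb s).2]) x y
    rw [hd] at h
    linarith
  obtain ⟨a, A, ha, hA, hAe⟩ := exists_pos_bounds bg.bounded bg.Ae_reg.1 bg.Ae_pos
  -- A_e (q - q₀)² = (𝒟(χ - χ₀))² / A_e, so the upper bound A of A_e enters the lower constant and a
  -- the upper one.
  refine ⟨cm / 2 / A, cM / 2 / a, by positivity, by positivity, fun χ hχ => ?_⟩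
  have hD2 : BddCont Ω fun x => opD lam σ Ae B (fun y => χ y - χ₀ y) x ^ 2 :=
    (bg.bddCont_opD lam σ (hχ.sub hχ₀)).comp (continuous_pow 2)
  have hR := (bg.bddCont_casimirRemainder lam σ ν hw.continuous hw'.continuous hχ₀
    hχ).integrableOn bg.isOpen bg.bounded
  have hsq : ∀ x ∈ Ω, ∀ c : ℝ,
      Ae x * (c * (opD lam σ Ae B χ x / Ae x - opD lam σ Ae B χ₀ x / Ae x) ^ 2) =
        c / Ae x * opD lam σ Ae B (fun y => χ y - χ₀ y) x ^ 2 := fun x hx c => by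
    have hne := (bg.Ae_pos' hx).ne'
    rw [bg.opD_sub lam σ hχ hχ₀ hx]
    field_simp
  rw [← integral_const_mul, ← integral_const_mul, casimirRemainder]
  constructor
  · refine setIntegral_mono_on ((hD2.const_mul _).integrableOn bg.isOpen bg.bounded) hR
      bg.isOpen.measurableSet fun x hx => ?_
    refine le_trans ?_ (mul_le_mul_of_nonneg_left (hlow _ _) (bg.Ae_pos' hx).le)
    rw [hsq x hx]
    exact mul_le_mul_of_nonneg_right
      (div_le_div_of_nonneg_left (by positivity) (bg.Ae_pos' hx) (hAe x hx).2) (sq_nonneg _)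
  · refine setIntegral_mono_on hR ((hD2.const_mul _).integrableOn bg.isOpen bg.bounded)
      bg.isOpen.measurableSet fun x hx => ?_
    refine (mul_le_mul_of_nonneg_left (hup _ _) (bg.Ae_pos' hx).le).trans ?_
    rw [hsq x hx]
    exact mul_le_mul_of_nonneg_right
      (div_le_div_of_nonneg_left (by positivity) ha (hAe x hx).1) (sq_nonneg _)

/-- The energy of `χ + γ`, expanded around a critical point `χ₀`. -/
theorem form_sub_of_isCritical (bg : Background Ω Ae B) {lam σ γ ν : ℝ} {w : ℝ → ℝ}
    (hw : ν = 0 ∨ Differentiable ℝ w ∧ Continuous (deriv w)) {χ₀ χ : E3 → ℝ}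
    (hχ₀ : ContDiffUpTo 2 χ₀ Ω) (hcrit : IsCritical lam σ Ω Ae B γ ν w χ₀)
    (hχ : ContDiffUpTo 2 χ Ω) (hbd : ∀ x ∈ frontier Ω, χ x - χ₀ x = 0) :
    form lam σ Ω Ae B (fun x => χ x - χ₀ x) (fun x => χ x - χ₀ x) =
      form lam σ Ω Ae B (fun x => χ x + γ) (fun x => χ x + γ) -
        form lam σ Ω Ae B (fun x => χ₀ x + γ) (fun x => χ₀ x + γ) +
        2 * (ν * ∫ x in Ω, deriv w (opD lam σ Ae B χ₀ x / Ae x) *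
          opD lam σ Ae B (fun y => χ y - χ₀ y) x) := by
  -- Exact expansion about χ₀ + γ with increment χ - χ₀; the Euler–Lagrange identity then replaces
  -- the cross term.
  have h1 := bg.form_add_mul lam σ (f := fun x => χ₀ x + γ) (g := fun x => χ x - χ₀ x)
    (hχ₀.add (.const γ)) (hχ.sub hχ₀) 1
  have h2 := bg.form_add_integral_eq_zero_of_isCritical hw hχ₀ hcrit (hχ.sub hχ₀) hbd
  have h3 : (fun x => χ₀ x + γ + 1 * (χ x - χ₀ x)) = fun x => χ x + γ := by
    ext x
    ring
  rw [h3] at h1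
  linarith

end Background

end GHM

end

/-! ### The stability estimate -/

theorem theorem1
    (lam σ : ℝ) (hlam : 0 < lam) (hσ : 0 < σ)
    (Ω : Set GHM.E3) (hΩo : IsOpen Ω) (hΩb : Bornology.IsBounded Ω)
    (Ae : GHM.E3 → ℝ) (B : GHM.E3 → GHM.E3)
    (hAe : GHM.ContDiffUpTo 2 Ae Ω) (hB : GHM.ContDiffUpTo 2 B Ω)
    (hAepos : ∀ x ∈ closure Ω, 0 < Ae x) (hBpos : ∀ x ∈ closure Ω, 0 < ‖B x‖)
    (γ ν : ℝ) (w : ℝ → ℝ) (cm cM : ℝ)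
    (hint : GHM.Integrability Ω Ae B →
      Differentiable ℝ w ∧ Differentiable ℝ (deriv w) ∧ 0 < cm ∧
        ∀ s, cm ≤ ν * deriv (deriv w) s ∧ ν * deriv (deriv w) s ≤ cM)
    (hnonint : ¬ GHM.Integrability Ω Ae B → ν = 0)
    (χ₀ : GHM.E3 → ℝ) (hχ₀ : GHM.ContDiffUpTo 2 χ₀ Ω)
    (hcrit : GHM.IsCritical lam σ Ω Ae B γ ν w χ₀)
    (hbd : ∀ x ∈ frontier Ω, Ae x * (χ₀ x + γ) = 0) :
    ∃ C : ℝ, 0 < C ∧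
      ∀ χ : ℝ → GHM.E3 → ℝ, GHM.IsSolution lam σ Ω Ae B χ →
        (∀ t, 0 ≤ t → ∀ x ∈ frontier Ω, χ t x - χ₀ x = 0) →
        ∀ t, 0 ≤ t →
          GHM.normPerpSq lam σ Ω Ae B (fun x => χ t x - χ₀ x) ≤
            C * GHM.normPerpSq lam σ Ω Ae B (fun x => χ 0 x - χ₀ x) := by
  have bg : GHM.Background Ω Ae B := ⟨hΩo, hΩb, hAe, hB, hAepos, hBpos⟩
  obtain ⟨c, C, hc, hC, hform⟩ := bg.exists_form_bounds hlam hσ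
  have hbdγ : ∀ χ : ℝ → GHM.E3 → ℝ, (∀ t, 0 ≤ t → ∀ x ∈ frontier Ω, χ t x - χ₀ x = 0) →
      ∀ t, 0 ≤ t → ∀ x ∈ frontier Ω, χ t x + γ = 0 := by
    intro χ h t ht x hx
    have h1 := (mul_eq_zero.1 (hbd x hx)).resolve_left
      (hAepos x (frontier_subset_closure hx)).ne'
    linarith [h t ht x hx]
  by_cases hI : GHM.Integrability Ω Ae B
  · obtain ⟨hw, hw', hcm, hb⟩ := hint hI
    obtain ⟨d, D, hd, hD, hcas⟩ := bg.exists_casimirRemainder_bounds lam σ hw hw' hcm hb hχ₀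
    -- c and C control the form, which enters the conserved sum with a factor 1/2; d and D control
    -- the enstrophy remainder.
    refine ⟨max (C / 2) D / min (c / 2) d, by positivity, fun χ sol hχbd t ht => ?_⟩
    -- The right-hand side does not depend on s. The linear terms in 𝒟(χ - χ₀) coming from the form
    -- and from the remainder cancel.
    have hN : ∀ s, 0 ≤ s →
        GHM.form lam σ Ω Ae B (fun x => χ s x - χ₀ x) (fun x => χ s x - χ₀ x) / 2 +
          GHM.Background.casimirRemainder lam σ Ω Ae B ν w χ₀ (χ s) =
        GHM.form lam σ Ω Ae B (fun x => χ 0 x + γ) (fun x => χ 0 x + γ) / 2 -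
          GHM.form lam σ Ω Ae B (fun x => χ₀ x + γ) (fun x => χ₀ x + γ) / 2 +
          ν * GHM.enstrophy lam σ Ω Ae B w (χ 0) - ν * GHM.enstrophy lam σ Ω Ae B w χ₀ := by
      intro s hs
      rw [bg.form_sub_of_isCritical (.inr ⟨hw, hw'.continuous⟩) hχ₀ hcrit (sol.reg hs) (hχbd s hs),
        bg.casimirRemainder_eq lam σ ν hw.continuous hw'.continuous hχ₀ (sol.reg hs),
        sol.form_eq_initial bg (hbdγ χ hχbd) hs,
        sol.enstrophy_eq_initial bg hI (hbdγ χ hχbd) hw hw'.continuous hs]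
      ring
    have hcons := (hN t ht).trans (hN 0 le_rfl).symm
    have hlow := (hform _ ((sol.reg ht).sub hχ₀)).1
    have hup := (hform _ ((sol.reg le_rfl).sub hχ₀)).2
    have hlow' := (hcas _ (sol.reg ht)).1
    have hup' := (hcas _ (sol.reg le_rfl)).2
    simp only [GHM.normPerpSq, if_pos hI]
    have hS : ∀ s, 0 ≤ (∫ x in Ω, (χ s x - χ₀ x) ^ 2) +
        ∫ x in Ω, ‖GHM.gradPerp B (fun x => χ s x - χ₀ x) x‖ ^ 2 := fun s =>
      add_nonneg (integral_nonneg fun _ => sq_nonneg _) (integral_nonneg fun _ => sq_nonneg _)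
    have hT : ∀ s, 0 ≤ ∫ x in Ω, GHM.opD lam σ Ae B (fun x => χ s x - χ₀ x) x ^ 2 := fun s =>
      integral_nonneg fun _ => sq_nonneg _
    rw [div_mul_eq_mul_div, le_div_iff₀ (by positivity), mul_comm]
    have e1 := mul_le_mul_of_nonneg_right (min_le_left (c / 2) d) (hS t)
    have e2 := mul_le_mul_of_nonneg_right (min_le_right (c / 2) d) (hT t)
    have e3 := mul_le_mul_of_nonneg_right (le_max_left (C / 2) D) (hS 0)
    have e4 := mul_le_mul_of_nonneg_right (le_max_right (C / 2) D) (hT 0)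
    rw [mul_add (min (c / 2) d), mul_add (max (C / 2) D)]
    linarith
  · have hν := hnonint hI
    refine ⟨C / c, by positivity, fun χ sol hχbd t ht => ?_⟩
    -- With ν = 0 the form of χ - χ₀ is itself conserved.
    have hN : ∀ s, 0 ≤ s →
        GHM.form lam σ Ω Ae B (fun x => χ s x - χ₀ x) (fun x => χ s x - χ₀ x) =
        GHM.form lam σ Ω Ae B (fun x => χ 0 x + γ) (fun x => χ 0 x + γ) -
          GHM.form lam σ Ω Ae B (fun x => χ₀ x + γ) (fun x => χ₀ x + γ) := by
      intro s hs
      rw [bg.form_sub_of_isCritical (.inl hν) hχ₀ hcrit (sol.reg hs) (hχbd s hs),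
        sol.form_eq_initial bg (hbdγ χ hχbd) hs, hν]
      ring
    have hcons := (hN t ht).trans (hN 0 le_rfl).symm
    have hlow := (hform _ ((sol.reg ht).sub hχ₀)).1
    have hup := (hform _ ((sol.reg le_rfl).sub hχ₀)).2
    simp only [GHM.normPerpSq, if_neg hI, add_zero]
    rw [div_mul_eq_mul_div, le_div_iff₀ hc, mul_comm]
    linarith
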